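/- Let $k$ be a field of characteristic $0$, $H=k[s]$ with $\Delta(s)=s\otimes1+1\otimes s$, and $s^{(n)}=s^n/n!$; tensor products without subscript are over $k$. A Lie $H$-pseudoalgebra is an $H$-module $L$ with a map $L\times L\to (H\otimes H)\otimes_H L$, $(a,b)\mapsto[a,b]$, which is biadditive, satisfies $[fa,gb]=((f\otimes g)\otimes_H1)[a,b]$ for $f,g\in H$, and satisfies asymmetry $[a,b]=-((12)\otimes_H1)[b,a]$ and the Jacobi identity $[[a,b],c]=[a,[b,c]]-((12)\otimes_H1)[b,[a,c]]$ in $H^{\otimes3}\otimes_HL$. Here $H^{\otimes 2}$ and $H^{\otimes3}$ are $H$-modules through $\Delta$ and $(\Delta\otimes1)\Delta$, and the bracket is extended by $[F\otimes_Ha,c]=(F\otimes1)\,((\Delta\otimes1)\otimes_H1)[a,c]$ and $[a,F\otimes_Hb]=(1\otimes F)\,((1\otimes\Delta)\otimes_H1)[a,b]$. A Schrödinger–Virasoro Lie $H$-pseudoalgebra is a Lie $H$-pseudoalgebra $L$ that is a free $H$-module with a basis $e_0,e_1,e_2,e_3$ such that $$[e_0,e_0]=(s\otimes1-1\otimes s)\otimes_He_0,\quad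 [e_0,e_i]=\beta_i\otimes_He_i\ (1\le i\le3),\quad [e_1,e_1]=\alpha'\otimes_He_2,\quad [e_1,e_2]=\eta\otimes_He_2,$$ $$[e_1,e_3]=\eta_{11}\otimes_He_1+\eta_{12}\otimes_He_2,\quad [e_2,e_3]=\eta_{21}\otimes_He_1+\eta_{22}\otimes_He_2,\quad [e_2,e_2]=[e_3,e_3]=0,$$ where $\beta_i=\lambda_is\otimes1-1\otimes s+\kappa_i\otimes1$ with $\lambda_i,\kappa_i\in k$, and $\alpha',\eta,\eta_{ij}\in H\otimes H$. **Theorem.** Let $L$ be a Schrödinger–Virasoro Lie $H$-pseudoalgebra with brackets as above. Suppose that $\eta=0$, $\alpha'\ne0$, and $\eta_{11},\eta_{12},\eta_{21},\eta_{22}$ are not all zero. Then the coefficients are as in one of (E1)–(E16) below. In (E1)–(E13), $\eta_{11}=\eta_{21}=\eta_{22}=\eta=0$, $\eta_{12}\neq0$, and $\alpha'$ is, for some $w\in k\setminus\{0\}$, one of * $\alpha'_1=w(1\otimes s-s\otimes1)$, with $\lambda_2=2\lambda_1-1$, $\kappa_2=2\kappa_1$; * $\alpha'_2=-w\big(\kappa_1(1\otimes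 s^{(2)}-s^{(2)}\otimes1)-(s\otimes s^{(2)}-s^{(2)}\otimes s)-\frac{\kappa_1^2}2(1\otimes s-s\otimes1)\big)$, with $\lambda_1=0$, $\lambda_2=-3$, $\kappa_2=2\kappa_1$; * $\alpha''_2=w\big((1\otimes s^{(2)}-s^{(2)}\otimes1)-\kappa_1(1\otimes s-s\otimes1)\big)$, with $\lambda_1=\frac12$, $\lambda_2=-1$, $\kappa_2=2\kappa_1$; * $\alpha'_3=w\big((1\otimes s^{(3)}-s^{(3)}\otimes1)+\frac12(s\otimes s^{(2)}-s^{(2)}\otimes s)-\frac{3\kappa_1}2(1\otimes s^{(2)}-s^{(2)}\otimes1)+\frac34\kappa_1^2(1\otimes s-s\otimes1)\big)$, with $\lambda_1=\frac23$, $\lambda_2=-\frac53$, $\kappa_2=2\kappa_1$. Moreover, with all $b_{ij}\in k$ and $\kappa_3=\kappa_2-\kappa_1$ in (E1)–(E13): * (E1) $\lambda_2=\lambda_1-1$, $\lambda_3=0$, $\eta_{12}=b_{01}(-\kappa_3\otimes1+1\otimes s)$. * (E2) $\lambda_3=\lambda_2-\lambda_1$, $\eta_{12}=b_{00}\otimes1$.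 * (E3) $\lambda_2=\lambda_1-2$, $\lambda_3=0$, $\eta_{12}=b_{11}\big((\kappa_1(\kappa_2-\kappa_1)+\lambda_1(\kappa_2-\kappa_1)^2)\otimes1-(\kappa_1+2\lambda_1(\kappa_2-\kappa_1))\otimes s+2\lambda_1\otimes s^{(2)}-(\kappa_2-\kappa_1)s\otimes1+s\otimes s\big)$. * (E4) $\lambda_1=0$, $\lambda_2=-2$, $\lambda_3=0$, $\eta_{12}=b_{11}\big(\kappa_1(\kappa_2-\kappa_1)\otimes1-(\kappa_2-\kappa_1)s\otimes1-\kappa_1\otimes s+s\otimes s\big)$. * (E5) $\lambda_1=\kappa_1=0$, $\lambda_2=-2$, $\lambda_3=0$, $\eta_{12}=b_{11}(-\kappa_3s\otimes1+s\otimes s)$. * (E6) $\lambda_3=\lambda_2-\lambda_1+1$, $\eta_{12}=-(\kappa_1b_{10}+(\kappa_2-\kappa_1)b_{01})\otimes1+b_{10}s\otimes1+b_{01}\otimes s$, where $b_{10}\ne0$ and $\lambda_1b_{10}+(\lambda_2-\lambda_1+1)b_{01}=0$. * (E7) $\lambda_1=0$, $\lambda_3=\lambda_2+1$, $\eta_{12}=b_{10}(-\kappa_1\otimes1+s\otimes1)$.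 * (E8) $\lambda_1=0$, $\lambda_2\ne-2$, $\lambda_3=\lambda_2+2$, $\eta_{12}=\frac{b_{20}}{2(\lambda_2+2)}\big(\kappa_1((\lambda_2+2)\kappa_1+(\kappa_2-\kappa_1))\otimes1-\kappa_1\otimes s-(2(\lambda_2+2)\kappa_1+(\kappa_2-\kappa_1))s\otimes1+s\otimes s+2(\lambda_2+2)s^{(2)}\otimes1\big)$. * (E9) $\lambda_1\neq1$, $\lambda_2=-1$, $\lambda_3=1-\lambda_1$, $\eta_{12}=b_{20}\big((\frac{\lambda_1}{2\lambda_1-2}(\kappa_2-\kappa_1)^2+\frac{1-2\lambda_1}{2-2\lambda_1}\kappa_1(\kappa_2-\kappa_1)+\frac12\kappa_1^2)\otimes1+(\frac{(2\lambda_1-1)(\kappa_2-\kappa_1)}{2-2\lambda_1}-\kappa_1)s\otimes1+\frac{(2\lambda_1-1)\kappa_1+2\lambda_1(\kappa_2-\kappa_1)}{2-2\lambda_1}\otimes s-\frac{\lambda_1}{1-\lambda_1}\otimes s^{(2)}+\frac{1-2\lambda_1}{2-2\lambda_1}s\otimes s+s^{(2)}\otimes1\big)$. * (E10) $\lambda_1=0$,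 $\lambda_2=-1$, $\lambda_3=2$, $\eta_{12}=b_{30}\big(s^{(3)}\otimes1-\frac12(\kappa_1+\kappa_2)s^{(2)}\otimes1+\frac12s^{(2)}\otimes s+\frac1{12}(\kappa_1^2+4\kappa_1\kappa_2+\kappa_2^2)s\otimes1-\frac16(2\kappa_1+\kappa_2)s\otimes s+\frac16s\otimes s^{(2)}-\frac1{12}(\kappa_1\kappa_2^2+\kappa_1^2\kappa_2)\otimes1+\frac1{12}(\kappa_1^2+2\kappa_1\kappa_2)\otimes s-\frac16\kappa_1\otimes s^{(2)}\big)$. * (E11) $\lambda_1=\frac23$, $\lambda_2=-\frac53$, $\lambda_3=\frac23$, $\eta_{12}=b_{30}\big((s^{(3)}\otimes1-1\otimes s^{(3)})+\frac12(s^{(2)}\otimes s-s\otimes s^{(2)})-\frac12(\kappa_1+\kappa_2)s^{(2)}\otimes1+\frac12(2\kappa_2-\kappa_1)\otimes s^{(2)}-\frac14(\kappa_1^2-4\kappa_1\kappa_2+\kappa_2^2)s\otimes1+\frac14(\kappa_1^2+2\kappa_1\kappa_2-2\kappa_2^2)\otimes s+\frac12(\kappa_2-2\kappa_1)s\otimes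 s+\frac1{12}(2\kappa_1-\kappa_2)(\kappa_1^2-\kappa_1\kappa_2-2\kappa_2^2)\otimes1\big)$. * (E12) $\lambda_1=0$, $\lambda_2=-3$, $\lambda_3=0$, $\eta_{12}=b_{21}\big((s^{(2)}\otimes s-s\otimes s^{(2)})+(\kappa_1\otimes s^{(2)}-(\kappa_2-\kappa_1)s^{(2)}\otimes1)+\frac12(\kappa_2-\kappa_1)(3\kappa_1-\kappa_2)s\otimes1+\frac12\kappa_1(3\kappa_1-2\kappa_2)\otimes s+(\kappa_2-2\kappa_1)s\otimes s+\frac12\kappa_1(\kappa_2-\kappa_1)(\kappa_2-2\kappa_1)\otimes1\big)$. * (E13) $\lambda_1=2$, $\lambda_2=-1$, $\lambda_3=0$, $\eta_{12}=b_{21}\big(s^{(2)}\otimes s+3s\otimes s^{(2)}-(\kappa_2-\kappa_1)s^{(2)}\otimes1-3(2\kappa_2-\kappa_1)\otimes s^{(2)}-(3\kappa_2-2\kappa_1)s\otimes s+\frac12(\kappa_1^2-4\kappa_1\kappa_2+3\kappa_2^2)s\otimes1+\frac12(\kappa_1^2-6\kappa_1\kappa_2+6\kappa_2^2)\otimes s-\frac12(\kappa_1^2\kappa_2-3\kappa_1\kappa_2^2+2\kappa_2^3)\otimes1+6\otimes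 s^{(3)}\big)$. In (E14)–(E16), $\eta=\eta_{21}=0$, $\eta_{11}=a_{00}\otimes1\ne0$, $\eta_{22}=2a_{00}\otimes1$, $\alpha'=w_{01}(1\otimes s-s\otimes1)\ne0$ and $\lambda_3=\kappa_3=0$ for some $a_{00},w_{01}\in k$, and * (E14) $\eta_{12}=0$, $\lambda_2=2\lambda_1-1$, $\kappa_2=2\kappa_1$. * (E15) $\eta_{12}=b_{00}\otimes1\ne0$, $\lambda_1=\lambda_2=1$, $\kappa_1=\kappa_2=0$. * (E16) $\eta_{12}=b_{10}(s\otimes1-1\otimes s)\ne0$, $\lambda_1=0$, $\lambda_2=-1$, $\kappa_1=\kappa_2=0$. Finally, consider the extended Schrödinger–Virasoro conformal algebra of Su–Yuan: the free $H$-module on $L,Y,M,N$ with $[L,L]=(1\otimes s-s\otimes1)\otimes_HL$, $[L,Y]=(1\otimes s-\frac12s\otimes1)\otimes_HY$, $[L,M]=(1\otimes s)\otimes_HM$, $[L,N]=(1\otimes s)\otimes_HN$, $[Y,Y]=(1\otimes s-s\otimes1)\otimes_HM$, $[Y,N]=-(1\otimes1)\otimes_HY$, $[M,N]=-(2\otimes1)\otimes_HM$,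 $[Y,M]=[M,M]=[N,N]=0$, the other brackets being determined by asymmetry. It is a Lie $H$-pseudoalgebra, and in the basis $e_0=-L$, $e_1=-Y$, $e_2=-M$, $e_3=-N$ it is a Schrödinger–Virasoro Lie $H$-pseudoalgebra of type (E14) with $a_{00}=1$, $w_{01}=-1$, $\lambda_1=\frac12$, $\kappa_1=0$. -/

import Mathlib

open Polynomial TensorProduct

noncomputable section

namespace SVPseudo

/-! ## The Hopf algebra `H = k[s]` and its tensor powers

`H` is `k[X]`, with `s = X` primitive.  `H2 k` is `H ⊗ H` and `H3 k` is `H ⊗ (H ⊗ H)`, tensor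
products over `k`, regarded as `H`-modules through the (iterated) coproduct.  As `H` is commutative,
left and right `H`-modules are not distinguished. -/

/-- `H ⊗ H`. -/
def H2 (k : Type*) [Field k] : Type _ := k[X] ⊗[k] k[X]

/-- `H ⊗ H ⊗ H`. -/
def H3 (k : Type*) [Field k] : Type _ := k[X] ⊗[k] (k[X] ⊗[k] k[X])

instance (k : Type*) [Field k] : CommRing (H2 k) :=
  inferInstanceAs (CommRing (k[X] ⊗[k] k[X]))

instance (k : Type*) [Field k] : CommRing (H3 k) :=
  inferInstanceAs (CommRing (k[X] ⊗[k] (k[X] ⊗[k] k[X])))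

instance (k : Type*) [Field k] : Algebra k (H2 k) :=
  inferInstanceAs (Algebra k (k[X] ⊗[k] k[X]))

instance (k : Type*) [Field k] : Algebra k (H3 k) :=
  inferInstanceAs (Algebra k (k[X] ⊗[k] (k[X] ⊗[k] k[X])))

/-- The pure tensor `f ⊗ g` in `H ⊗ H`. -/
def tens {k : Type*} [Field k] (f g : k[X]) : H2 k := f ⊗ₜ[k] g

/-- The pure tensor `f ⊗ g ⊗ h` in `H ⊗ H ⊗ H`. -/
def tens3 {k : Type*} [Field k] (f g h : k[X]) : H3 k := f ⊗ₜ[k] (g ⊗ₜ[k] h)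

infixl:100 " ⊠ " => tens

/-- The divided power `s⁽ⁿ⁾ = sⁿ / n!`. -/
def dp {k : Type*} [Field k] (n : ℕ) : k[X] := C ((n.factorial : k)⁻¹) * X ^ n

/-- The coproduct `Δ`, the algebra map with `Δ s = s ⊗ 1 + 1 ⊗ s`. -/
def comul (k : Type*) [Field k] : k[X] →ₐ[k] H2 k := aeval (X ⊠ 1 + 1 ⊠ X)

/-- The iterated coproduct `(Δ ⊗ 1) Δ = (1 ⊗ Δ) Δ`. -/
def comul3 (k : Type*) [Field k] : k[X] →ₐ[k] H3 k :=
  aeval (tens3 X 1 1 + tens3 1 X 1 + tens3 1 1 X)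

/-- `H ⊗ H` as an `H`-module via `Δ`. -/
instance (k : Type*) [Field k] : Algebra k[X] (H2 k) := (comul k).toRingHom.toAlgebra

/-- `H ⊗ H ⊗ H` as an `H`-module via the iterated coproduct. -/
instance (k : Type*) [Field k] : Algebra k[X] (H3 k) := (comul3 k).toRingHom.toAlgebra

/-- `F ↦ F ⊗ 1`. -/
def inclLeft (k : Type*) [Field k] : H2 k →ₐ[k] H3 k :=
  ((Algebra.TensorProduct.assoc k k k k[X] k[X] k[X]).toAlgHom.comp
    (Algebra.TensorProduct.includeLeft : k[X] ⊗[k] k[X] →ₐ[k] (k[X] ⊗[k] k[X]) ⊗[k] k[X]) :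
    k[X] ⊗[k] k[X] →ₐ[k] k[X] ⊗[k] (k[X] ⊗[k] k[X]))

/-- `F ↦ 1 ⊗ F`. -/
def inclRight (k : Type*) [Field k] : H2 k →ₐ[k] H3 k :=
  (Algebra.TensorProduct.includeRight :
    k[X] ⊗[k] k[X] →ₐ[k] k[X] ⊗[k] (k[X] ⊗[k] k[X]))

/-- `Δ ⊗ 1` before recording its `H`-linearity. -/
def comulLeftK (k : Type*) [Field k] : H2 k →ₐ[k] H3 k :=
  ((Algebra.TensorProduct.assoc k k k k[X] k[X] k[X]).toAlgHom.comp
    (Algebra.TensorProduct.map (show k[X] →ₐ[k] k[X] ⊗[k] k[X] from comul k)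
      (AlgHom.id k k[X])) :
    k[X] ⊗[k] k[X] →ₐ[k] k[X] ⊗[k] (k[X] ⊗[k] k[X]))

/-- `1 ⊗ Δ` before recording its `H`-linearity. -/
def comulRightK (k : Type*) [Field k] : H2 k →ₐ[k] H3 k :=
  (Algebra.TensorProduct.map (AlgHom.id k k[X])
    (show k[X] →ₐ[k] k[X] ⊗[k] k[X] from comul k) :
    k[X] ⊗[k] k[X] →ₐ[k] k[X] ⊗[k] (k[X] ⊗[k] k[X]))

/-- The flip `(12)` of `H ⊗ H` before recording its `H`-linearity. -/
def swapK (k : Type*) [Field k] : H2 k →ₐ[k] H2 k :=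
  ((Algebra.TensorProduct.comm k k[X] k[X]).toAlgHom :
    k[X] ⊗[k] k[X] →ₐ[k] k[X] ⊗[k] k[X])

/-- The flip `(12)` of the first two factors of `H ⊗ H ⊗ H` before recording its `H`-linearity. -/
def swap12K (k : Type*) [Field k] : H3 k →ₐ[k] H3 k :=
  ((Algebra.TensorProduct.leftComm k k[X] k[X] k[X]).toAlgHom :
    k[X] ⊗[k] (k[X] ⊗[k] k[X]) →ₐ[k] k[X] ⊗[k] (k[X] ⊗[k] k[X]))

theorem inclLeft_tens {k : Type*} [Field k] (f g : k[X]) : inclLeft k (f ⊠ g) = tens3 f g 1 := rfl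

theorem inclRight_tens {k : Type*} [Field k] (f g : k[X]) :
    inclRight k (f ⊠ g) = tens3 1 f g := rfl

theorem swapK_tens {k : Type*} [Field k] (f g : k[X]) : swapK k (f ⊠ g) = g ⊠ f := rfl

theorem swap12K_tens3 {k : Type*} [Field k] (f g h : k[X]) :
    swap12K k (tens3 f g h) = tens3 g f h := rfl

theorem comul_X (k : Type*) [Field k] : comul k X = X ⊠ 1 + 1 ⊠ X := by
  simp [comul]

theorem comul3_X (k : Type*) [Field k] :
    comul3 k X = tens3 X 1 1 + tens3 1 X 1 + tens3 1 1 X := by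
  simp [comul3]

theorem comulLeftK_tens {k : Type*} [Field k] (f g : k[X]) :
    comulLeftK k (f ⊠ g) = inclLeft k (comul k f) * tens3 1 1 g := by
  change Algebra.TensorProduct.assoc k k k k[X] k[X] k[X]
      ((show k[X] ⊗[k] k[X] from comul k f) ⊗ₜ[k] g) =
    Algebra.TensorProduct.assoc k k k k[X] k[X] k[X]
      ((show k[X] ⊗[k] k[X] from comul k f) ⊗ₜ[k] (1 : k[X])) *
    Algebra.TensorProduct.assoc k k k k[X] k[X] k[X]
      ((1 : k[X] ⊗[k] k[X]) ⊗ₜ[k] g)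
  rw [← map_mul, Algebra.TensorProduct.tmul_mul_tmul, mul_one, one_mul]

theorem comulRightK_tens {k : Type*} [Field k] (f g : k[X]) :
    comulRightK k (f ⊠ g) = tens3 f 1 1 * inclRight k (comul k g) := by
  change f ⊗ₜ[k] (show k[X] ⊗[k] k[X] from comul k g) =
    (f ⊗ₜ[k] (1 : k[X] ⊗[k] k[X])) * ((1 : k[X]) ⊗ₜ[k] (show k[X] ⊗[k] k[X] from comul k g))
  rw [Algebra.TensorProduct.tmul_mul_tmul, mul_one, one_mul]

theorem inclLeft_comul_X (k : Type*) [Field k] :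
    inclLeft k (comul k X) = tens3 X 1 1 + tens3 1 X 1 := by
  rw [comul_X, map_add, inclLeft_tens, inclLeft_tens]

theorem inclRight_comul_X (k : Type*) [Field k] :
    inclRight k (comul k X) = tens3 1 X 1 + tens3 1 1 X := by
  rw [comul_X, map_add, inclRight_tens, inclRight_tens]

theorem tens3_one (k : Type*) [Field k] : tens3 (1 : k[X]) 1 1 = 1 := rfl

theorem comulLeftK_comul (k : Type*) [Field k] (f : k[X]) :
    comulLeftK k (comul k f) = comul3 k f := by
  have h : (comulLeftK k).comp (comul k) = comul3 k := by
    apply Polynomial.algHom_ext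
    rw [AlgHom.comp_apply, comul_X, map_add, comulLeftK_tens, comulLeftK_tens, inclLeft_comul_X,
      map_one, map_one, tens3_one, mul_one, one_mul, comul3_X]
  exact DFunLike.congr_fun h f

theorem comulRightK_comul (k : Type*) [Field k] (f : k[X]) :
    comulRightK k (comul k f) = comul3 k f := by
  have h : (comulRightK k).comp (comul k) = comul3 k := by
    apply Polynomial.algHom_ext
    rw [AlgHom.comp_apply, comul_X, map_add, comulRightK_tens, comulRightK_tens, inclRight_comul_X,
      map_one, map_one, tens3_one, mul_one, one_mul, comul3_X, add_assoc]
  exact DFunLike.congr_fun h f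

theorem swapK_comul (k : Type*) [Field k] (f : k[X]) : swapK k (comul k f) = comul k f := by
  have h : (swapK k).comp (comul k) = comul k := by
    apply Polynomial.algHom_ext
    rw [AlgHom.comp_apply, comul_X, map_add, swapK_tens, swapK_tens, add_comm]
  exact DFunLike.congr_fun h f

theorem swap12K_comul3 (k : Type*) [Field k] (f : k[X]) :
    swap12K k (comul3 k f) = comul3 k f := by
  have h : (swap12K k).comp (comul3 k) = comul3 k := by
    apply Polynomial.algHom_ext
    rw [AlgHom.comp_apply, comul3_X, map_add, map_add, swap12K_tens3, swap12K_tens3,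
      swap12K_tens3, add_comm (tens3 1 X 1)]
  exact DFunLike.congr_fun h f

/-- `Δ ⊗ 1 : H ⊗ H → H ⊗ H ⊗ H`, as an `H`-linear algebra map. -/
def comulLeft (k : Type*) [Field k] : H2 k →ₐ[k[X]] H3 k :=
  { (comulLeftK k).toRingHom with commutes' := comulLeftK_comul k }

/-- `1 ⊗ Δ : H ⊗ H → H ⊗ H ⊗ H`, as an `H`-linear algebra map. -/
def comulRight (k : Type*) [Field k] : H2 k →ₐ[k[X]] H3 k :=
  { (comulRightK k).toRingHom with commutes' := comulRightK_comul k }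

/-- `(12)` on `H ⊗ H`, as an `H`-linear algebra map. -/
def swap (k : Type*) [Field k] : H2 k →ₐ[k[X]] H2 k :=
  { (swapK k).toRingHom with commutes' := swapK_comul k }

/-- `(12)` on `H ⊗ H ⊗ H`, as an `H`-linear algebra map. -/
def swap12 (k : Type*) [Field k] : H3 k →ₐ[k[X]] H3 k :=
  { (swap12K k).toRingHom with commutes' := swap12K_comul3 k }

/-! ## Lie `H`-pseudoalgebras -/

/-- A pseudoproduct on the `H`-module `L`: a biadditive map `(a, b) ↦ a * b` from `L × L` to
`(H ⊗ H) ⊗_H L` with `(f a) * (g b) = ((f ⊗ g) ⊗_H 1) (a * b)`. -/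
structure Pseudobracket (k : Type*) [Field k] (L : Type*) [AddCommGroup L] [Module k[X] L] where
  /-- the pseudoproduct -/
  br : L → L → H2 k ⊗[k[X]] L
  add_left : ∀ a a' b, br (a + a') b = br a b + br a' b
  add_right : ∀ a b b', br a (b + b') = br a b + br a b'
  sesq : ∀ (f g : k[X]) (a b : L), br (f • a) (g • b) = (f ⊠ g) • br a b

namespace Pseudobracket

variable {k : Type*} [Field k] {L : Type*} [AddCommGroup L] [Module k[X] L]

theorem smul_left (p : Pseudobracket k L) (f : k[X]) (a b : L) :
    p.br (f • a) b = (f ⊠ 1) • p.br a b := by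
  simpa using p.sesq f 1 a b

theorem smul_right (p : Pseudobracket k L) (f : k[X]) (a b : L) :
    p.br a (f • b) = (1 ⊠ f) • p.br a b := by
  simpa using p.sesq 1 f a b

theorem comulLeft_smul (F : H2 k) (x : H2 k ⊗[k[X]] L) :
    (comulLeft k).toLinearMap.rTensor L (F • x) =
      comulLeft k F • (comulLeft k).toLinearMap.rTensor L x := by
  induction x with
  | zero => simp
  | add x y hx hy => simp only [smul_add, map_add, hx, hy]
  | tmul G a => simp [TensorProduct.smul_tmul']

theorem comulRight_smul (F : H2 k) (x : H2 k ⊗[k[X]] L) :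
    (comulRight k).toLinearMap.rTensor L (F • x) =
      comulRight k F • (comulRight k).toLinearMap.rTensor L x := by
  induction x with
  | zero => simp
  | add x y hx hy => simp only [smul_add, map_add, hx, hy]
  | tmul G a => simp [TensorProduct.smul_tmul']

/-- The extension of the pseudoproduct to `((H ⊗ H) ⊗_H L) × L → (H ⊗ H ⊗ H) ⊗_H L`:
`(F ⊗_H a) * c = (F ⊗ 1) · ((Δ ⊗ 1) ⊗_H 1) (a * c)`. -/
def extLeft (p : Pseudobracket k L) (c : L) : H2 k ⊗[k[X]] L →+ H3 k ⊗[k[X]] L :=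
  TensorProduct.liftAddHom
    (AddMonoidHom.mk' (fun F : H2 k =>
        AddMonoidHom.mk' (fun a : L =>
            inclLeft k F • (comulLeft k).toLinearMap.rTensor L (p.br a c))
          (by intro a b; rw [p.add_left, map_add, smul_add]))
      (by intro F G; ext a; simp [add_smul]))
    (by
      intro f F a
      change inclLeft k (comul k f * F) • (comulLeft k).toLinearMap.rTensor L (p.br a c) =
        inclLeft k F • (comulLeft k).toLinearMap.rTensor L (p.br (f • a) c)
      have h : comulLeft k (f ⊠ 1) = inclLeft k (comul k f) := by
        change comulLeftK k (f ⊠ 1) = _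
        rw [comulLeftK_tens, tens3_one, mul_one]
      rw [p.smul_left, comulLeft_smul, h, smul_smul, map_mul, mul_comm])

/-- The extension of the pseudoproduct to `L × ((H ⊗ H) ⊗_H L) → (H ⊗ H ⊗ H) ⊗_H L`:
`a * (F ⊗_H b) = (1 ⊗ F) · ((1 ⊗ Δ) ⊗_H 1) (a * b)`. -/
def extRight (p : Pseudobracket k L) (a : L) : H2 k ⊗[k[X]] L →+ H3 k ⊗[k[X]] L :=
  TensorProduct.liftAddHom
    (AddMonoidHom.mk' (fun F : H2 k =>
        AddMonoidHom.mk' (fun b : L =>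
            inclRight k F • (comulRight k).toLinearMap.rTensor L (p.br a b))
          (by intro b b'; rw [p.add_right, map_add, smul_add]))
      (by intro F G; ext a; simp [add_smul]))
    (by
      intro f F b
      change inclRight k (comul k f * F) • (comulRight k).toLinearMap.rTensor L (p.br a b) =
        inclRight k F • (comulRight k).toLinearMap.rTensor L (p.br a (f • b))
      have h : comulRight k (1 ⊠ f) = inclRight k (comul k f) := by
        change comulRightK k (1 ⊠ f) = _
        rw [comulRightK_tens, tens3_one, one_mul]
      rw [p.smul_right, comulRight_smul, h, smul_smul, map_mul, mul_comm])

/-- The axioms of a Lie `H`-pseudoalgebra: asymmetry and the Jacobi identity. -/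
structure IsLie (p : Pseudobracket k L) : Prop where
  skew : ∀ a b : L, p.br a b = -(swap k).toLinearMap.rTensor L (p.br b a)
  jacobi : ∀ a b c : L, p.extLeft c (p.br a b) =
    p.extRight a (p.br b c) - (swap12 k).toLinearMap.rTensor L (p.extRight b (p.br a c))

end Pseudobracket

/-! ## Schrödinger–Virasoro Lie `H`-pseudoalgebras -/

/-- The coefficients of the brackets of a Schrödinger–Virasoro Lie `H`-pseudoalgebra in a basis:
`lᵢ, kᵢ` are the scalars `λᵢ, κᵢ` in `βᵢ = λᵢ s ⊗ 1 - 1 ⊗ s + κᵢ ⊗ 1`, and `alpha` is `α'`. -/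
structure Coeffs (k : Type*) [Field k] where
  (l1 l2 l3 k1 k2 k3 : k)
  (alpha eta eta11 eta12 eta21 eta22 : H2 k)

/-- `λ s ⊗ 1 - 1 ⊗ s + κ ⊗ 1`. -/
def beta {k : Type*} [Field k] (l κ : k) : H2 k := l • X ⊠ 1 - 1 ⊠ X + κ • 1 ⊠ 1

/-- The brackets of a Schrödinger–Virasoro Lie `H`-pseudoalgebra in the basis `e₀, e₁, e₂, e₃`. -/
structure HasBrackets {k : Type*} [Field k] {L : Type*} [AddCommGroup L] [Module k[X] L]
    (p : Pseudobracket k L) (e : Module.Basis (Fin 4) k[X] L) (d : Coeffs k) : Prop where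
  b00 : p.br (e 0) (e 0) = (X ⊠ 1 - 1 ⊠ X : H2 k) ⊗ₜ[k[X]] e 0
  b01 : p.br (e 0) (e 1) = beta d.l1 d.k1 ⊗ₜ[k[X]] e 1
  b02 : p.br (e 0) (e 2) = beta d.l2 d.k2 ⊗ₜ[k[X]] e 2
  b03 : p.br (e 0) (e 3) = beta d.l3 d.k3 ⊗ₜ[k[X]] e 3
  b11 : p.br (e 1) (e 1) = d.alpha ⊗ₜ[k[X]] e 2
  b12 : p.br (e 1) (e 2) = d.eta ⊗ₜ[k[X]] e 2
  b13 : p.br (e 1) (e 3) = d.eta11 ⊗ₜ[k[X]] e 1 + d.eta12 ⊗ₜ[k[X]] e 2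
  b23 : p.br (e 2) (e 3) = d.eta21 ⊗ₜ[k[X]] e 1 + d.eta22 ⊗ₜ[k[X]] e 2
  b22 : p.br (e 2) (e 2) = 0
  b33 : p.br (e 3) (e 3) = 0

namespace Coeffs

variable {k : Type*} [Field k]

/-! ### The four nonzero types of `α'` (with the weights that they require) -/

/-- `α' = α'₁`. -/
def IsAlpha1 (d : Coeffs k) : Prop :=
  d.l2 = 2 * d.l1 - 1 ∧ d.k2 = 2 * d.k1 ∧
  ∃ w : k, w ≠ 0 ∧ d.alpha = w • (1 ⊠ dp 1 - dp 1 ⊠ 1)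

/-- `α' = α'₂`. -/
def IsAlpha2 (d : Coeffs k) : Prop :=
  d.l1 = 0 ∧ d.l2 = -3 ∧ d.k2 = 2 * d.k1 ∧
  ∃ w : k, w ≠ 0 ∧ d.alpha = -w • (d.k1 • (1 ⊠ dp 2 - dp 2 ⊠ 1)
    - (dp 1 ⊠ dp 2 - dp 2 ⊠ dp 1) - (d.k1 ^ 2 / 2) • (1 ⊠ dp 1 - dp 1 ⊠ 1))

/-- `α' = α''₂`. -/
def IsAlpha2' (d : Coeffs k) : Prop :=
  d.l1 = 1 / 2 ∧ d.l2 = -1 ∧ d.k2 = 2 * d.k1 ∧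
  ∃ w : k, w ≠ 0 ∧ d.alpha =
    w • ((1 ⊠ dp 2 - dp 2 ⊠ 1) - d.k1 • (1 ⊠ dp 1 - dp 1 ⊠ 1))

/-- `α' = α'₃`. -/
def IsAlpha3 (d : Coeffs k) : Prop :=
  d.l1 = 2 / 3 ∧ d.l2 = -5 / 3 ∧ d.k2 = 2 * d.k1 ∧
  ∃ w : k, w ≠ 0 ∧ d.alpha = w • ((1 ⊠ dp 3 - dp 3 ⊠ 1)
    + (1 / 2 : k) • (dp 1 ⊠ dp 2 - dp 2 ⊠ dp 1)
    - (3 * d.k1 / 2) • (1 ⊠ dp 2 - dp 2 ⊠ 1)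
    + (3 / 4 * d.k1 ^ 2) • (1 ⊠ dp 1 - dp 1 ⊠ 1))

/-- The conditions common to the first thirteen families:
`η₁₁ = η₂₁ = η₂₂ = 0`, `η = 0`, `η₁₂ ≠ 0`, and `α'` is one of `α'₁, α'₂, α''₂, α'₃`. -/
def Common (d : Coeffs k) : Prop :=
  d.eta11 = 0 ∧ d.eta21 = 0 ∧ d.eta22 = 0 ∧ d.eta = 0 ∧ d.eta12 ≠ 0 ∧
  (d.IsAlpha1 ∨ d.IsAlpha2 ∨ d.IsAlpha2' ∨ d.IsAlpha3)

/-! ### The sixteen families -/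

def E1 (d : Coeffs k) : Prop :=
  d.Common ∧ d.l2 = d.l1 - 1 ∧ d.k2 = d.k1 + d.k3 ∧ d.l3 = 0 ∧
  ∃ b01 : k, d.eta12 = b01 • (-d.k3 • 1 ⊠ 1 + 1 ⊠ dp 1)

def E2 (d : Coeffs k) : Prop :=
  d.Common ∧ d.l3 = d.l2 - d.l1 ∧ d.k3 = d.k2 - d.k1 ∧
  ∃ b00 : k, d.eta12 = b00 • 1 ⊠ 1

def E3 (d : Coeffs k) : Prop :=
  d.Common ∧ d.l2 = d.l1 - 2 ∧ d.l3 = 0 ∧ d.k3 = d.k2 - d.k1 ∧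
  ∃ b11 : k, d.eta12 = b11 •
    ((d.k1 * (d.k2 - d.k1) + d.l1 * (d.k2 - d.k1) ^ 2) • 1 ⊠ 1
      - (d.k1 + 2 * d.l1 * (d.k2 - d.k1)) • 1 ⊠ dp 1
      + (2 * d.l1) • 1 ⊠ dp 2 - (d.k2 - d.k1) • dp 1 ⊠ 1 + dp 1 ⊠ dp 1)

def E4 (d : Coeffs k) : Prop :=
  d.Common ∧ d.l1 = 0 ∧ d.l2 = -2 ∧ d.l3 = 0 ∧ d.k3 = d.k2 - d.k1 ∧
  ∃ b11 : k, d.eta12 = b11 •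
    ((d.k1 * (d.k2 - d.k1)) • 1 ⊠ 1 - (d.k2 - d.k1) • dp 1 ⊠ 1
      - d.k1 • 1 ⊠ dp 1 + dp 1 ⊠ dp 1)

def E5 (d : Coeffs k) : Prop :=
  d.Common ∧ d.l1 = 0 ∧ d.k1 = 0 ∧ d.l2 = -2 ∧ d.l3 = 0 ∧ d.k3 = d.k2 ∧
  ∃ b11 : k, d.eta12 = b11 • (-d.k3 • dp 1 ⊠ 1 + dp 1 ⊠ dp 1)

def E6 (d : Coeffs k) : Prop :=
  d.Common ∧ d.l3 = d.l2 - d.l1 + 1 ∧ d.k3 = d.k2 - d.k1 ∧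
  ∃ b10 b01 : k, b10 ≠ 0 ∧ d.l1 * b10 + (d.l2 - d.l1 + 1) * b01 = 0 ∧
    d.eta12 = -(d.k1 * b10 + (d.k2 - d.k1) * b01) • 1 ⊠ 1 + b10 • dp 1 ⊠ 1 + b01 • 1 ⊠ dp 1

def E7 (d : Coeffs k) : Prop :=
  d.Common ∧ d.l1 = 0 ∧ d.l3 = d.l2 + 1 ∧ d.k3 = d.k2 - d.k1 ∧
  ∃ b10 : k, d.eta12 = b10 • (-d.k1 • 1 ⊠ 1 + dp 1 ⊠ 1)

def E8 (d : Coeffs k) : Prop :=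
  d.Common ∧ d.l1 = 0 ∧ d.l2 ≠ -2 ∧ d.l3 = d.l2 + 2 ∧ d.k3 = d.k2 - d.k1 ∧
  ∃ b20 : k, d.eta12 = (b20 / (2 * (d.l2 + 2))) •
    ((d.k1 * ((d.l2 + 2) * d.k1 + (d.k2 - d.k1))) • 1 ⊠ 1 - d.k1 • 1 ⊠ dp 1
      - (2 * (d.l2 + 2) * d.k1 + (d.k2 - d.k1)) • dp 1 ⊠ 1 + dp 1 ⊠ dp 1
      + (2 * (d.l2 + 2)) • dp 2 ⊠ 1)

def E9 (d : Coeffs k) : Prop :=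
  d.Common ∧ d.l1 ≠ 1 ∧ d.l2 = -1 ∧ d.l3 = 1 - d.l1 ∧ d.k3 = d.k2 - d.k1 ∧
  ∃ b20 : k, d.eta12 = b20 •
    ((d.l1 / (2 * d.l1 - 2) * (d.k2 - d.k1) ^ 2
        + (1 - 2 * d.l1) / (2 - 2 * d.l1) * d.k1 * (d.k2 - d.k1) + 1 / 2 * d.k1 ^ 2) • 1 ⊠ 1
      + ((2 * d.l1 - 1) * (d.k2 - d.k1) / (2 - 2 * d.l1) - d.k1) • dp 1 ⊠ 1
      + (((2 * d.l1 - 1) * d.k1 + 2 * d.l1 * (d.k2 - d.k1)) / (2 - 2 * d.l1)) • 1 ⊠ dp 1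
      - (d.l1 / (1 - d.l1)) • 1 ⊠ dp 2
      + ((1 - 2 * d.l1) / (2 - 2 * d.l1)) • dp 1 ⊠ dp 1 + dp 2 ⊠ 1)

def E10 (d : Coeffs k) : Prop :=
  d.Common ∧ d.l1 = 0 ∧ d.l2 = -1 ∧ d.l3 = 2 ∧ d.k3 = d.k2 - d.k1 ∧
  ∃ b30 : k, d.eta12 = b30 •
    (dp 3 ⊠ 1 - (1 / 2 * (d.k1 + d.k2)) • dp 2 ⊠ 1 + (1 / 2 : k) • dp 2 ⊠ dp 1
      + (1 / 12 * (d.k1 ^ 2 + 4 * d.k1 * d.k2 + d.k2 ^ 2)) • dp 1 ⊠ 1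
      - (1 / 6 * (2 * d.k1 + d.k2)) • dp 1 ⊠ dp 1 + (1 / 6 : k) • dp 1 ⊠ dp 2
      - (1 / 12 * (d.k1 * d.k2 ^ 2 + d.k1 ^ 2 * d.k2)) • 1 ⊠ 1
      + (1 / 12 * (d.k1 ^ 2 + 2 * d.k1 * d.k2)) • 1 ⊠ dp 1
      - (1 / 6 * d.k1) • 1 ⊠ dp 2)

def E11 (d : Coeffs k) : Prop :=
  d.Common ∧ d.l1 = 2 / 3 ∧ d.l2 = -5 / 3 ∧ d.l3 = 2 / 3 ∧ d.k3 = d.k2 - d.k1 ∧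
  ∃ b30 : k, d.eta12 = b30 •
    ((dp 3 ⊠ 1 - 1 ⊠ dp 3) + (1 / 2 : k) • (dp 2 ⊠ dp 1 - dp 1 ⊠ dp 2)
      - (1 / 2 * (d.k1 + d.k2)) • dp 2 ⊠ 1 + (1 / 2 * (2 * d.k2 - d.k1)) • 1 ⊠ dp 2
      - (1 / 4 * (d.k1 ^ 2 - 4 * d.k1 * d.k2 + d.k2 ^ 2)) • dp 1 ⊠ 1
      + (1 / 4 * (d.k1 ^ 2 + 2 * d.k1 * d.k2 - 2 * d.k2 ^ 2)) • 1 ⊠ dp 1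
      + (1 / 2 * (d.k2 - 2 * d.k1)) • dp 1 ⊠ dp 1
      + (1 / 12 * (2 * d.k1 - d.k2) * (d.k1 ^ 2 - d.k1 * d.k2 - 2 * d.k2 ^ 2)) • 1 ⊠ 1)

def E12 (d : Coeffs k) : Prop :=
  d.Common ∧ d.l1 = 0 ∧ d.l2 = -3 ∧ d.l3 = 0 ∧ d.k3 = d.k2 - d.k1 ∧
  ∃ b21 : k, d.eta12 = b21 •
    ((dp 2 ⊠ dp 1 - dp 1 ⊠ dp 2) + (d.k1 • 1 ⊠ dp 2 - (d.k2 - d.k1) • dp 2 ⊠ 1)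
      + ((1 / 2 * (d.k2 - d.k1) * (3 * d.k1 - d.k2)) • dp 1 ⊠ 1
        + (1 / 2 * d.k1 * (3 * d.k1 - 2 * d.k2)) • 1 ⊠ dp 1)
      + (d.k2 - 2 * d.k1) • dp 1 ⊠ dp 1
      + (1 / 2 * d.k1 * (d.k2 - d.k1) * (d.k2 - 2 * d.k1)) • 1 ⊠ 1)

def E13 (d : Coeffs k) : Prop :=
  d.Common ∧ d.l1 = 2 ∧ d.l2 = -1 ∧ d.l3 = 0 ∧ d.k3 = d.k2 - d.k1 ∧
  ∃ b21 : k, d.eta12 = b21 •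
    (dp 2 ⊠ dp 1 + (3 : k) • dp 1 ⊠ dp 2 - (d.k2 - d.k1) • dp 2 ⊠ 1
      - (3 * (2 * d.k2 - d.k1)) • 1 ⊠ dp 2 - (3 * d.k2 - 2 * d.k1) • dp 1 ⊠ dp 1
      + (1 / 2 * (d.k1 ^ 2 - 4 * d.k1 * d.k2 + 3 * d.k2 ^ 2)) • dp 1 ⊠ 1
      + (1 / 2 * (d.k1 ^ 2 - 6 * d.k1 * d.k2 + 6 * d.k2 ^ 2)) • 1 ⊠ dp 1
      - (1 / 2 * (d.k1 ^ 2 * d.k2 - 3 * d.k1 * d.k2 ^ 2 + 2 * d.k2 ^ 3)) • 1 ⊠ 1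
      + (6 : k) • 1 ⊠ dp 3)

/-- The conditions common to the last three families: `η₁₁ = a ⊗ 1`, `η₂₂ = 2a ⊗ 1`,
`α' = w (1 ⊗ s - s ⊗ 1)`, `η₂₁ = η = 0`. -/
def CommonLast (d : Coeffs k) (a w : k) : Prop :=
  a ≠ 0 ∧ d.eta11 = a • 1 ⊠ 1 ∧ d.eta22 = (2 * a) • 1 ⊠ 1 ∧ d.eta21 = 0 ∧ d.eta = 0 ∧
  w ≠ 0 ∧ d.alpha = w • (1 ⊠ dp 1 - dp 1 ⊠ 1)

/-- The fourteenth family with its parameters `a₀₀ = a`, `w₀₁ = w`, `λ₁ = l`, `κ₁ = κ`. -/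
def E14With (d : Coeffs k) (a w l κ : k) : Prop :=
  d.CommonLast a w ∧ d.eta12 = 0 ∧ d.l1 = l ∧ d.k1 = κ ∧ d.l2 = 2 * l - 1 ∧ d.k2 = 2 * κ ∧
  d.l3 = 0 ∧ d.k3 = 0

def E14 (d : Coeffs k) : Prop := ∃ a w l κ : k, d.E14With a w l κ

def E15 (d : Coeffs k) : Prop :=
  ∃ a w b00 : k, d.CommonLast a w ∧ b00 ≠ 0 ∧ d.eta12 = b00 • 1 ⊠ 1 ∧
  d.l1 = 1 ∧ d.k1 = 0 ∧ d.l2 = 1 ∧ d.k2 = 0 ∧ d.l3 = 0 ∧ d.k3 = 0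

def E16 (d : Coeffs k) : Prop :=
  ∃ a w b10 : k, d.CommonLast a w ∧ b10 ≠ 0 ∧ d.eta12 = b10 • (dp 1 ⊠ 1 - 1 ⊠ dp 1) ∧
  d.l1 = 0 ∧ d.k1 = 0 ∧ d.l2 = -1 ∧ d.k2 = 0 ∧ d.l3 = 0 ∧ d.k3 = 0

end Coeffs

/-! ## The extended Schrödinger–Virasoro Lie conformal algebra -/

/-- The pseudoproduct on the free module `H^n` with basis `v` and `vᵢ * vⱼ = ∑ₗ cᵢⱼₗ ⊗_H vₗ`. -/
def ofStructureConstants {k : Type*} [Field k] {n : ℕ} (c : Fin n → Fin n → Fin n → H2 k) :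
    Pseudobracket k (Fin n → k[X]) where
  br a b := ∑ i, ∑ j, ∑ l, (a i ⊠ b j * c i j l) ⊗ₜ[k[X]] (Pi.single l 1 : Fin n → k[X])
  add_left a a' b := by
    have h (f f' g : k[X]) : (f + f') ⊠ g = f ⊠ g + f' ⊠ g := TensorProduct.add_tmul f f' g
    simp [h, add_mul, TensorProduct.add_tmul, Finset.sum_add_distrib]
  add_right a b b' := by
    have h (f g g' : k[X]) : f ⊠ (g + g') = f ⊠ g + f ⊠ g' := TensorProduct.tmul_add f g g'
    simp [h, add_mul, TensorProduct.add_tmul, Finset.sum_add_distrib]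
  sesq f g a b := by
    have h (f g f' g' : k[X]) : (f * f') ⊠ (g * g') = f ⊠ g * f' ⊠ g' :=
      (Algebra.TensorProduct.tmul_mul_tmul f f' g g').symm
    simp [h, Finset.smul_sum, TensorProduct.smul_tmul', mul_assoc]

/-- The brackets of `L, Y, M, N` (numbered `0, 1, 2, 3`), `i ≤ j`; those not listed vanish. -/
def extSVUpper (k : Type*) [Field k] : Fin 4 → Fin 4 → Fin 4 → H2 k
  | 0, 0 => Pi.single 0 (1 ⊠ X - X ⊠ 1)
  | 0, 1 => Pi.single 1 (1 ⊠ X - (1 / 2 : k) • X ⊠ 1)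
  | 0, 2 => Pi.single 2 (1 ⊠ X)
  | 0, 3 => Pi.single 3 (1 ⊠ X)
  | 1, 1 => Pi.single 2 (1 ⊠ X - X ⊠ 1)
  | 1, 3 => Pi.single 1 (-(1 ⊠ 1))
  | 2, 3 => Pi.single 2 (-((2 : k) • 1 ⊠ 1))
  | _, _ => 0

/-- The extended Schrödinger–Virasoro Lie conformal algebra `H L ⊕ H Y ⊕ H M ⊕ H N`; the brackets
in the opposite order are determined by asymmetry.  In terms of `λ`-brackets:
`[L_λ L] = (∂ + 2λ) L`, `[L_λ Y] = (∂ + 3/2 λ) Y`, `[L_λ M] = (∂ + λ) M`, `[L_λ N] = (∂ + λ) N`,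
`[Y_λ Y] = (∂ + 2λ) M`, `[Y_λ N] = -Y`, `[M_λ N] = -2 M`. -/
def extSV (k : Type*) [Field k] : Pseudobracket k (Fin 4 → k[X]) :=
  ofStructureConstants fun i j l =>
    if i ≤ j then extSVUpper k i j l else -swap k (extSVUpper k j i l)

end SVPseudo

end

open SVPseudo

namespace SVPseudo

/-! ## Evaluation of tensors -/

section Evaluation

variable {k : Type*} [Field k]

/-! Read `H ⊗ H` and `H ⊗ H ⊗ H` as `k[x, y]` and `k[x, y, z]`. All structural maps become
substitutions, and every basis coefficient of a Jacobi identity becomes a functional equation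
between polynomials.

The Jacobi identity for `(e₀, eᵢ, eⱼ)` makes a bracket coefficient `F` an intertwiner: `(λ₁x - y +
κ₁) F(x+y, z) = (λ₂x - y - z + κ₂) F(y, z) - (λ₃x - z + κ₃) F(y, x+z)`. Differentiate at `(0, κ₁,
κ₃)`. Order 0 in `x` gives `κ₂ = κ₁ + κ₃` when `F ≠ 0`. Order 1 is Euler's equation, so `F` is
homogeneous about `(κ₁, κ₃)` of degree `N = λ₁ + λ₃ - λ₂`. Higher orders give a two-term recurrence
between the partial derivatives at that point (`IsIntertwiner.recurrence`). It has no nonzero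
solution for `N ≥ 4` (`recurrence_eq_zero`); solving it for `N ≤ 3` gives the lists in `alpha_cases`
and `eta12_cases`.

The remaining Jacobi identities decide which coefficients survive. Since `η = 0`, the triple `(e₁,
e₁, e₃)` gives `α'(x, y) η₂₁(x+y, z) = 0`, hence `η₂₁ = 0`, and expresses `α' η₂₂` through `η₁₁`. If
`η₁₁ = 0`, then `η₂₂ = 0` and only `η₁₂` is left: these are the first thirteen families. If `η₁₁ ≠
0`, the triple `(e₁, e₃, e₃)` makes `η₁₁(x, y) η₁₁(x+y, z)` symmetric in `y, z`, which forces `η₁₁`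
to be a scalar `a` with `λ₃ = κ₃ = 0`. Then `η₂₂ = 2a`, `α'` is linear, and the same triple
determines `η₁₂` by its restriction to `y = 0` (`last_cases`).

For the Su–Yuan algebra the axioms are checked on generators (`Pseudobracket.isLie_of_span`), where
they are finitely many polynomial identities. -/

theorem H2.induction {motive : H2 k → Prop} (F : H2 k) (zero : motive 0)
    (tens : ∀ f g : k[X], motive (f ⊠ g))
    (add : ∀ F G, motive F → motive G → motive (F + G)) : motive F :=
  TensorProduct.induction_on (motive := motive) F zero tens add

theorem H3.induction {motive : H3 k → Prop} (F : H3 k) (zero : motive 0)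
    (tens3 : ∀ f g h : k[X], motive (tens3 f g h))
    (add : ∀ F G, motive F → motive G → motive (F + G)) : motive F := by
  refine TensorProduct.induction_on (motive := motive) F zero (fun f G => ?_) add
  induction G with
  | zero => rw [TensorProduct.tmul_zero]; exact zero
  | tmul g h => exact tens3 f g h
  | add G G' hG hG' => rw [TensorProduct.tmul_add]; exact add _ _ hG hG'

theorem tens_mul (f g f' g' : k[X]) : f ⊠ g * f' ⊠ g' = (f * f') ⊠ (g * g') :=
  Algebra.TensorProduct.tmul_mul_tmul f f' g g'

theorem tens3_mul (f g h f' g' h' : k[X]) :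
    tens3 f g h * tens3 f' g' h' = tens3 (f * f') (g * g') (h * h') := by
  change (f ⊗ₜ[k] (g ⊗ₜ[k] h)) * (f' ⊗ₜ[k] (g' ⊗ₜ[k] h')) = _
  rw [Algebra.TensorProduct.tmul_mul_tmul, Algebra.TensorProduct.tmul_mul_tmul]
  rfl

theorem zero_tens (g : k[X]) : (0 : k[X]) ⊠ g = 0 := TensorProduct.zero_tmul _ g

theorem one_tens_one : (1 : k[X]) ⊠ 1 = 1 := rfl

/-- The value `F(x, y)` of `F ∈ H ⊗ H = k[x, y]`. -/
noncomputable def ev2 (x y : k) : H2 k →ₐ[k] k :=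
  (Algebra.TensorProduct.productMap (aeval x) (aeval y) : k[X] ⊗[k] k[X] →ₐ[k] k)

/-- The value `F(x, y, z)` of `F ∈ H ⊗ H ⊗ H = k[x, y, z]`. -/
noncomputable def ev3 (x y z : k) : H3 k →ₐ[k] k :=
  (Algebra.TensorProduct.productMap (aeval x)
    (Algebra.TensorProduct.productMap (aeval y) (aeval z)) :
    k[X] ⊗[k] (k[X] ⊗[k] k[X]) →ₐ[k] k)

@[simp] theorem ev2_tens (x y : k) (f g : k[X]) : ev2 x y (f ⊠ g) = f.eval x * g.eval y := by
  rw [← coe_aeval_eq_eval, ← coe_aeval_eq_eval]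
  exact Algebra.TensorProduct.productMap_apply_tmul _ _ f g

@[simp] theorem ev3_tens3 (x y z : k) (f g h : k[X]) :
    ev3 x y z (tens3 f g h) = f.eval x * (g.eval y * h.eval z) := by
  rw [← coe_aeval_eq_eval, ← coe_aeval_eq_eval, ← coe_aeval_eq_eval]
  refine (Algebra.TensorProduct.productMap_apply_tmul _ _ f (g ⊗ₜ[k] h)).trans ?_
  rw [Algebra.TensorProduct.productMap_apply_tmul]

@[simp] theorem ev2_comul (x y : k) (f : k[X]) : ev2 x y (comul k f) = f.eval (x + y) := by
  have h : (ev2 x y).comp (comul k) = aeval (x + y) := by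
    apply Polynomial.algHom_ext
    simp [comul_X]
  rw [← coe_aeval_eq_eval]
  exact DFunLike.congr_fun h f

@[simp] theorem ev3_inclLeft (x y z : k) (F : H2 k) : ev3 x y z (inclLeft k F) = ev2 x y F := by
  induction F using H2.induction with
  | zero => simp
  | tens f g => simp [inclLeft_tens]
  | add F G hF hG => simp [hF, hG]

@[simp] theorem ev3_inclRight (x y z : k) (F : H2 k) : ev3 x y z (inclRight k F) = ev2 y z F := by
  induction F using H2.induction with
  | zero => simp
  | tens f g => simp [inclRight_tens]
  | add F G hF hG => simp [hF, hG]

@[simp] theorem ev3_comulLeft (x y z : k) (F : H2 k) :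
    ev3 x y z (comulLeft k F) = ev2 (x + y) z F := by
  change ev3 x y z (comulLeftK k F) = ev2 (x + y) z F
  induction F using H2.induction with
  | zero => simp
  | tens f g => simp [comulLeftK_tens]
  | add F G hF hG => simp [hF, hG]

@[simp] theorem ev3_comulRight (x y z : k) (F : H2 k) :
    ev3 x y z (comulRight k F) = ev2 x (y + z) F := by
  change ev3 x y z (comulRightK k F) = ev2 x (y + z) F
  induction F using H2.induction with
  | zero => simp
  | tens f g => simp [comulRightK_tens]
  | add F G hF hG => simp [hF, hG]

@[simp] theorem ev2_swap (x y : k) (F : H2 k) : ev2 x y (swap k F) = ev2 y x F := by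
  change ev2 x y (swapK k F) = ev2 y x F
  induction F using H2.induction with
  | zero => simp
  | tens f g => simp [swapK_tens, mul_comm]
  | add F G hF hG => simp [hF, hG]

@[simp] theorem ev2_swapK (x y : k) (F : H2 k) : ev2 x y (swapK k F) = ev2 y x F :=
  ev2_swap x y F

@[simp] theorem ev3_swap12 (x y z : k) (F : H3 k) : ev3 x y z (swap12 k F) = ev3 y x z F := by
  change ev3 x y z (swap12K k F) = ev3 y x z F
  induction F using H3.induction with
  | zero => simp
  | tens3 f g h => simp [swap12K_tens3, mul_left_comm]
  | add F G hF hG => simp [hF, hG]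

end Evaluation

/-! ## Tensors are determined by their values and by their partial derivatives at a point -/

section Separation

variable {k : Type*} [Field k]

/-- A family of functionals that separates polynomials separates the elements of `k[X] ⊗ V`. -/
theorem eq_zero_of_rTensor_eq_zero {ι V : Type*} [AddCommGroup V] [Module k V]
    (φ : ι → k[X] →ₗ[k] k) (hφ : ∀ f, (∀ i, φ i f = 0) → f = 0) (F : k[X] ⊗[k] V)
    (h : ∀ i, TensorProduct.lid k V ((φ i).rTensor V F) = 0) : F = 0 := by
  have key (ψ : V →ₗ[k] k) (i : ι) (F : k[X] ⊗[k] V) :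
      φ i (TensorProduct.rid k k[X] (ψ.lTensor k[X] F)) =
        ψ (TensorProduct.lid k V ((φ i).rTensor V F)) := by
    induction F with
    | zero => simp
    | tmul f v => simp [mul_comm]
    | add F G hF hG => simp only [map_add, hF, hG]
  -- The coordinates of `F` along a `k`-basis of `V` are polynomials, and to these the separation
  -- hypothesis `hφ` applies.
  have repr (F : k[X] ⊗[k] V) (j) :
      (Algebra.TensorProduct.basis k[X] (Module.Basis.ofVectorSpace k V)).repr F j =
        TensorProduct.rid k k[X] (((Module.Basis.ofVectorSpace k V).coord j).lTensor k[X] F) := by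
    induction F with
    | zero => simp
    | tmul f v =>
      simp [Algebra.TensorProduct.basis_repr_tmul, Algebra.smul_def, mul_comm]
    | add F G hF hG => simp only [map_add, Finsupp.add_apply, hF, hG]
  apply (Algebra.TensorProduct.basis k[X] (Module.Basis.ofVectorSpace k V)).repr.injective
  ext1 j
  rw [repr, map_zero, Finsupp.zero_apply]
  apply hφ
  intro i
  rw [key, h, map_zero]

/-- Separates one tensor factor at a time. It serves both for values at points and for partial
derivatives at a fixed point. -/
theorem H2.eq_zero_of_functionals {ι κ : Type*} (φ : ι → k[X] →ₗ[k] k) (ψ : κ → k[X] →ₗ[k] k)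
    (hφ : ∀ f, (∀ i, φ i f = 0) → f = 0) (hψ : ∀ f, (∀ i, ψ i f = 0) → f = 0)
    (T : ι → κ → H2 k →+ k) (hT : ∀ i j f g, T i j (f ⊠ g) = φ i f * ψ j g)
    (F : H2 k) (h : ∀ i j, T i j F = 0) : F = 0 := by
  refine eq_zero_of_rTensor_eq_zero φ hφ (V := k[X]) F fun i => hψ _ fun j => ?_
  rw [← h i j]
  clear h
  induction F using H2.induction with
  | zero => exact (map_zero ((ψ j).comp ((TensorProduct.lid k k[X]).toLinearMap.comp
      ((φ i).rTensor k[X])))).trans (map_zero (T i j)).symm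
  | tens f g =>
    rw [hT]
    change ψ j (TensorProduct.lid k k[X] ((φ i).rTensor k[X] (f ⊗ₜ g))) = _
    simp
  | add F G hF hG =>
    rw [map_add, ← hF, ← hG]
    exact map_add ((ψ j).comp ((TensorProduct.lid k k[X]).toLinearMap.comp
      ((φ i).rTensor k[X]))) F G

/-- The `n`-th derivative at `a`. -/
noncomputable def jet (a : k) (n : ℕ) : k[X] →ₗ[k] k :=
  (leval a).comp (derivative ^ n)

theorem jet_apply (a : k) (n : ℕ) (f : k[X]) : jet a n f = (derivative^[n] f).eval a := by
  simp [jet, Module.End.pow_apply]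

/-- `k[X] ⊗ k[X]` is isomorphic to the domain `k[X][X]`. -/
theorem H2.mul_eq_zero {F G : H2 k} (h : F * G = 0) : F = 0 ∨ G = 0 := by
  let φ : k[X][X] ≃ₐ[k] H2 k :=
    (polyEquivTensor k k[X] : k[X][X] ≃ₐ[k] k[X] ⊗[k] k[X])
  have h' : φ.symm F * φ.symm G = 0 := by
    rw [← map_mul, h, map_zero]
  rcases _root_.mul_eq_zero.mp h' with h' | h'
  · exact Or.inl ((map_eq_zero_iff φ.symm φ.symm.injective).mp h')
  · exact Or.inr ((map_eq_zero_iff φ.symm φ.symm.injective).mp h')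

variable [CharZero k]

theorem eq_zero_of_eval (f : k[X]) (h : ∀ x, leval x f = 0) : f = 0 :=
  Polynomial.funext fun x => by simpa using h x

theorem H2.eq_zero_of_ev2 (F : H2 k) (h : ∀ x y, ev2 x y F = 0) : F = 0 :=
  H2.eq_zero_of_functionals leval leval eq_zero_of_eval eq_zero_of_eval
    (fun x y => (ev2 x y : H2 k →+ k)) (fun x y f g => by simp) F h

theorem H2.ext_ev2 {F G : H2 k} (h : ∀ x y, ev2 x y F = ev2 x y G) : F = G :=
  sub_eq_zero.mp (H2.eq_zero_of_ev2 _ fun x y => by rw [map_sub, h, sub_self])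

theorem H3.ext_ev3 {F G : H3 k} (h : ∀ x y z, ev3 x y z F = ev3 x y z G) : F = G := by
  refine sub_eq_zero.mp (eq_zero_of_rTensor_eq_zero leval eq_zero_of_eval
    (V := k[X] ⊗[k] k[X]) (F - G) fun x => H2.eq_zero_of_ev2 _ fun y z => ?_)
  have key (F : H3 k) : ev2 y z ((TensorProduct.lid k (k[X] ⊗[k] k[X])
      ((leval x).rTensor (k[X] ⊗[k] k[X]) F) : k[X] ⊗[k] k[X])) = ev3 x y z F := by
    induction F using H3.induction with
    | zero => exact (map_zero ((ev2 y z).toLinearMap.comp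
        ((TensorProduct.lid k (k[X] ⊗[k] k[X])).toLinearMap.comp
          ((leval x).rTensor (k[X] ⊗[k] k[X]))))).trans (map_zero (ev3 x y z)).symm
    | tens3 f g h =>
      rw [ev3_tens3, ← ev2_tens]
      change ev2 y z (TensorProduct.lid k (k[X] ⊗[k] k[X])
        ((leval x).rTensor (k[X] ⊗[k] k[X]) (f ⊗ₜ[k] (g ⊗ₜ[k] h)))) = _
      rw [LinearMap.rTensor_tmul, TensorProduct.lid_tmul]
      exact map_smul (ev2 y z) (f.eval x) (g ⊠ h)
    | add F G hF hG =>
      rw [map_add, ← hF, ← hG]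
      exact map_add ((ev2 y z).toLinearMap.comp
        ((TensorProduct.lid k (k[X] ⊗[k] k[X])).toLinearMap.comp
          ((leval x).rTensor (k[X] ⊗[k] k[X])))) F G
  refine (key (F - G)).trans ?_
  rw [map_sub, h, sub_self]

/-- The `n`-th derivative at `a` is `n!` times the `n`-th Taylor coefficient, and `n!` is invertible
in characteristic zero. -/
theorem eq_zero_of_jet (a : k) (f : k[X]) (h : ∀ n, jet a n f = 0) : f = 0 := by
  apply (taylor_injective a)
  ext n
  have h1 := congrArg (eval a) (congrFun (factorial_smul_hasseDeriv (R := k) n) f)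
  have h2 := h n
  rw [jet_apply] at h2
  rw [h2] at h1
  simp only [nsmul_eq_mul] at h1
  rw [taylor_coeff, map_zero, coeff_zero]
  simpa [n.factorial_ne_zero] using h1

end Separation

/-! ## Partial derivatives of tensors -/

section Jets

variable {k : Type*} [Field k]

/-- Leibniz rule. The truncated `n - 1` at `n = 0` is harmless, as it comes with the factor `n`; the
same holds in the multivariable versions. -/
theorem jet_X_mul (a : k) (n : ℕ) (f : k[X]) :
    jet a n (X * f) = a * jet a n f + n * jet a (n - 1) f := by
  have key : derivative^[n] (X * f) = X * derivative^[n] f + n • derivative^[n - 1] f := by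
    induction n with
    | zero => simp
    | succ n ih =>
      rw [Function.iterate_succ_apply', ih, Function.iterate_succ_apply']
      cases n with
      | zero => simp [add_comm]
      | succ n =>
        have e : derivative (derivative^[n] f) = derivative^[n + 1] f :=
          (Function.iterate_succ_apply' derivative n f).symm
        simp only [map_add, map_nsmul, derivative_mul, derivative_X, one_mul,
          Nat.add_sub_cancel, e, succ_nsmul]
        abel
  rw [jet_apply, jet_apply, jet_apply, key]
  simp

theorem jet_one (a : k) (n : ℕ) : jet a n (1 : k[X]) = if n = 0 then 1 else 0 := by
  rw [jet_apply]
  split_ifs with h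
  · simp [h]
  · rw [iterate_derivative_one (Nat.pos_of_ne_zero h), eval_zero]

theorem jet_sub_pow (a : k) (n m : ℕ) :
    jet a n ((X - C a) ^ m) = if n = m then (n.factorial : k) else 0 := by
  rw [jet_apply, iterate_derivative_X_sub_pow]
  split_ifs with h
  · subst h; simp [Nat.descFactorial_self]
  · rcases lt_or_gt_of_ne h with h | h
    · simp [Nat.sub_ne_zero_of_lt h]
    · simp [Nat.descFactorial_of_lt h]

/-- The partial derivative `∂ₓⁱ ∂ᵧʲ F (a, b)`. -/
noncomputable def jet2 (a b : k) (i j : ℕ) : H2 k →ₗ[k] k :=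
  (LinearMap.mul' k k ∘ₗ TensorProduct.map (jet a i) (jet b j) : k[X] ⊗[k] k[X] →ₗ[k] k)

/-- The partial derivative `∂ₓⁱ ∂ᵧʲ ∂_zˡ F (a, b, c)`. -/
noncomputable def jet3 (a b c : k) (i j l : ℕ) : H3 k →ₗ[k] k :=
  (LinearMap.mul' k k ∘ₗ TensorProduct.map (jet a i)
    (LinearMap.mul' k k ∘ₗ TensorProduct.map (jet b j) (jet c l)) :
    k[X] ⊗[k] (k[X] ⊗[k] k[X]) →ₗ[k] k)

@[simp] theorem jet2_tens (a b : k) (i j : ℕ) (f g : k[X]) :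
    jet2 a b i j (f ⊠ g) = jet a i f * jet b j g := rfl

@[simp] theorem jet3_tens3 (a b c : k) (i j l : ℕ) (f g h : k[X]) :
    jet3 a b c i j l (tens3 f g h) = jet a i f * (jet b j g * jet c l h) := rfl

theorem jet2_X_left (a b : k) (i j : ℕ) (F : H2 k) :
    jet2 a b i j (X ⊠ 1 * F) = a * jet2 a b i j F + i * jet2 a b (i - 1) j F := by
  induction F using H2.induction with
  | zero => simp
  | tens f g => simp only [tens_mul, jet2_tens, one_mul, jet_X_mul]; ring
  | add F G hF hG => simp only [mul_add, map_add, hF, hG]; ring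

theorem jet2_X_right (a b : k) (i j : ℕ) (F : H2 k) :
    jet2 a b i j (1 ⊠ X * F) = b * jet2 a b i j F + j * jet2 a b i (j - 1) F := by
  induction F using H2.induction with
  | zero => simp
  | tens f g => simp only [tens_mul, jet2_tens, one_mul, jet_X_mul]; ring
  | add F G hF hG => simp only [mul_add, map_add, hF, hG]; ring

theorem jet3_X_one (a b c : k) (i j l : ℕ) (F : H3 k) :
    jet3 a b c i j l (tens3 X 1 1 * F) =
      a * jet3 a b c i j l F + i * jet3 a b c (i - 1) j l F := by
  induction F using H3.induction with
  | zero => simp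
  | tens3 f g h => simp only [tens3_mul, jet3_tens3, one_mul, jet_X_mul]; ring
  | add F G hF hG => simp only [mul_add, map_add, hF, hG]; ring

theorem jet3_X_two (a b c : k) (i j l : ℕ) (F : H3 k) :
    jet3 a b c i j l (tens3 1 X 1 * F) =
      b * jet3 a b c i j l F + j * jet3 a b c i (j - 1) l F := by
  induction F using H3.induction with
  | zero => simp
  | tens3 f g h => simp only [tens3_mul, jet3_tens3, one_mul, jet_X_mul]; ring
  | add F G hF hG => simp only [mul_add, map_add, hF, hG]; ring

theorem jet3_X_three (a b c : k) (i j l : ℕ) (F : H3 k) :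
    jet3 a b c i j l (tens3 1 1 X * F) =
      c * jet3 a b c i j l F + l * jet3 a b c i j (l - 1) F := by
  induction F using H3.induction with
  | zero => simp
  | tens3 f g h => simp only [tens3_mul, jet3_tens3, one_mul, jet_X_mul]; ring
  | add F G hF hG => simp only [mul_add, map_add, hF, hG]; ring

/-- `Δ f` is `f(x + y)`, so only the total order of differentiation matters. -/
theorem jet2_comul (a b : k) (i j : ℕ) (f : k[X]) :
    jet2 a b i j (comul k f) = jet (a + b) (i + j) f := by
  induction f using Polynomial.induction_on' generalizing i j with
  | add f g hf hg => simp only [map_add, hf, hg]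
  | monomial n r =>
    rw [← C_mul_X_pow_eq_monomial, ← smul_eq_C_mul, map_smul, map_smul, map_smul]
    congr 1
    induction n generalizing i j with
    | zero =>
      rw [pow_zero, map_one, ← one_tens_one, jet2_tens, jet_one, jet_one, jet_one]
      rcases i with _ | i <;> rcases j with _ | j <;> simp
    | succ n ih =>
      rw [pow_succ', map_mul, comul_X, add_mul, map_add, jet2_X_left, jet2_X_right, jet_X_mul,
        ih, ih, ih]
      rcases i with _ | i <;> rcases j with _ | j
      · simp; ring
      · simp; ring
      · simp; ring
      · rw [show i + 1 - 1 + (j + 1) = i + j + 1 by omega,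
          show i + 1 + (j + 1 - 1) = i + j + 1 by omega,
          show i + 1 + (j + 1) - 1 = i + j + 1 by omega]
        push_cast
        ring

theorem jet3_inclRight (a b c : k) (i j l : ℕ) (F : H2 k) :
    jet3 a b c i j l (inclRight k F) = if i = 0 then jet2 b c j l F else 0 := by
  induction F using H2.induction with
  | zero => simp
  | tens f g => rw [inclRight_tens, jet3_tens3, jet_one, jet2_tens]; split_ifs <;> simp
  | add F G hF hG => rw [map_add, map_add, hF, hG, map_add]; split_ifs <;> simp

theorem jet3_inclLeft_mul (a b c : k) (i j l : ℕ) (F : H2 k) (g : k[X]) :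
    jet3 a b c i j l (inclLeft k F * tens3 1 1 g) = jet2 a b i j F * jet c l g := by
  induction F using H2.induction with
  | zero => simp
  | tens f h => simp [inclLeft_tens, tens3_mul, mul_assoc]
  | add F G hF hG => simp only [map_add, add_mul, hF, hG]

theorem jet3_mul_inclRight (a b c : k) (i j l : ℕ) (F : H2 k) (f : k[X]) :
    jet3 a b c i j l (tens3 f 1 1 * inclRight k F) = jet a i f * jet2 b c j l F := by
  induction F using H2.induction with
  | zero => simp
  | tens g h => simp [inclRight_tens, tens3_mul]
  | add F G hF hG => simp only [map_add, mul_add, hF, hG]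

theorem jet3_comulLeft (a b c : k) (i j l : ℕ) (F : H2 k) :
    jet3 a b c i j l (comulLeft k F) = jet2 (a + b) c (i + j) l F := by
  change jet3 a b c i j l (comulLeftK k F) = _
  induction F using H2.induction with
  | zero => simp
  | tens f g => rw [comulLeftK_tens, jet3_inclLeft_mul, jet2_comul, jet2_tens]
  | add F G hF hG => simp only [map_add, hF, hG]

theorem jet3_comulRight (a b c : k) (i j l : ℕ) (F : H2 k) :
    jet3 a b c i j l (comulRight k F) = jet2 a (b + c) i (j + l) F := by
  change jet3 a b c i j l (comulRightK k F) = _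
  induction F using H2.induction with
  | zero => simp
  | tens f g => rw [comulRightK_tens, jet3_mul_inclRight, jet2_comul, jet2_tens]
  | add F G hF hG => simp only [map_add, hF, hG]

theorem jet3_swap12 (a b c : k) (i j l : ℕ) (F : H3 k) :
    jet3 a b c i j l (swap12 k F) = jet3 b a c j i l F := by
  change jet3 a b c i j l (swap12K k F) = _
  induction F using H3.induction with
  | zero => simp
  | tens3 f g h => simp [swap12K_tens3, mul_left_comm]
  | add F G hF hG => simp only [map_add, hF, hG]

variable [CharZero k]

theorem H2.eq_zero_of_jet2 (a b : k) (F : H2 k) (h : ∀ i j, jet2 a b i j F = 0) : F = 0 :=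
  H2.eq_zero_of_functionals (jet a) (jet b) (eq_zero_of_jet a) (eq_zero_of_jet b)
    (fun i j => (jet2 a b i j).toAddMonoidHom) (fun _ _ _ _ => rfl) F h

/-- Taylor expansion of a tensor whose partial derivatives at `(a, b)` vanish outside order `N`. -/
theorem H2.eq_sum_of_jet2 (a b : k) (N : ℕ) (F : H2 k)
    (h : ∀ i j, i + j ≠ N → jet2 a b i j F = 0) (x y : k) :
    ev2 x y F = ∑ i ∈ Finset.range (N + 1), jet2 a b i (N - i) F *
      ((i.factorial : k)⁻¹ * (x - a) ^ i * (((N - i).factorial : k)⁻¹ * (y - b) ^ (N - i))) := by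
  have hF : F = ∑ i ∈ Finset.range (N + 1), (jet2 a b i (N - i) F * ((i.factorial : k)⁻¹ *
      ((N - i).factorial : k)⁻¹)) • ((X - C a) ^ i) ⊠ ((X - C b) ^ (N - i)) := by
    -- The two sides have the same partial derivatives at `(a, b)`: powers of `X - C a` and `X - C
    -- b` are dual to `jet` up to factorials.
    rw [← sub_eq_zero]
    refine H2.eq_zero_of_jet2 a b _ fun i j => ?_
    rw [map_sub, map_sum]
    simp only [map_smul, jet2_tens, jet_sub_pow, smul_eq_mul]
    by_cases hij : i + j = N
    · rw [Finset.sum_eq_single i]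
      · have h1 : N - i = j := by omega
        have hi : (i.factorial : k) ≠ 0 := Nat.cast_ne_zero.mpr i.factorial_ne_zero
        have hj : (j.factorial : k) ≠ 0 := Nat.cast_ne_zero.mpr j.factorial_ne_zero
        simp only [h1, if_true]
        field_simp
        ring
      · intro l _ hl
        simp [Ne.symm hl]
      · intro hi
        simp at hi
        omega
    · rw [h i j hij, Finset.sum_eq_zero, sub_zero]
      intro l hl
      rw [Finset.mem_range] at hl
      split_ifs with h1 h2
      · omega
      all_goals simp
  conv_lhs => rw [hF]
  rw [map_sum]
  refine Finset.sum_congr rfl fun i _ => ?_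
  simp
  ring

end Jets

/-! ## Equivariant bilinear maps between tensor density modules -/

section Intertwiner

variable {k : Type*} [Field k]

@[simp] theorem ev2_beta (l κ x y : k) : ev2 x y (beta l κ) = l * x - y + κ := by
  simp [beta]

/-- `F` is the coefficient of a map `M(l₁, κ₁) × M(l₃, κ₃) → M(l₂, κ₂)` commuting with `e₀`. -/
def IsIntertwiner (l1 κ1 l3 κ3 l2 κ2 : k) (F : H2 k) : Prop :=
  inclLeft k (beta l1 κ1) * comulLeft k F = inclRight k F * comulRight k (beta l2 κ2) -
    swap12 k (inclRight k (beta l3 κ3) * comulRight k F)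

variable [CharZero k] {l1 κ1 l3 κ3 l2 κ2 : k} {F : H2 k}

theorem inclLeft_beta (l κ : k) :
    inclLeft k (beta l κ) = l • tens3 X 1 1 - tens3 1 X 1 + κ • 1 :=
  H3.ext_ev3 fun x y z => by simp

theorem comulRight_beta (l κ : k) :
    comulRight k (beta l κ) = l • tens3 X 1 1 - tens3 1 X 1 - tens3 1 1 X + κ • 1 :=
  H3.ext_ev3 fun x y z => by simp; ring

theorem swap12_inclRight_beta (l κ : k) :
    swap12 k (inclRight k (beta l κ)) = l • tens3 X 1 1 - tens3 1 1 X + κ • 1 :=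
  H3.ext_ev3 fun x y z => by simp

namespace IsIntertwiner

/-- The derivative of order `(m, j, l)` of the intertwining equation at `(0, κ₁, κ₃)`. This base
point cancels the constant terms `κ₁` and `κ₃` of the linear factors. Since `F(y, z)` does not
involve `x`, its term contributes only for `m ≤ 1`. -/
theorem jet3_eq (h : IsIntertwiner l1 κ1 l3 κ3 l2 κ2 F) (m j l : ℕ) :
    l1 * (m * jet2 κ1 κ3 (m - 1 + j) l F) - j * jet2 κ1 κ3 (m + (j - 1)) l F =
      l2 * (m * (if m - 1 = 0 then jet2 κ1 κ3 j l F else 0)) +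
      (if m = 0 then (κ2 - κ1 - κ3) * jet2 κ1 κ3 j l F - j * jet2 κ1 κ3 (j - 1) l F
        - l * jet2 κ1 κ3 j (l - 1) F else 0) -
      (l3 * (m * jet2 κ1 κ3 j (m - 1 + l) F) - l * jet2 κ1 κ3 j (m + (l - 1)) F) := by
  rw [IsIntertwiner, map_mul (swap12 k), swap12_inclRight_beta, inclLeft_beta, comulRight_beta,
    mul_comm (inclRight k F)] at h
  have e := congrArg (jet3 0 κ1 κ3 m j l) h
  simp only [add_mul, sub_mul, smul_mul_assoc, one_mul, map_add, map_sub, map_smul, jet3_X_one,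
    jet3_X_two, jet3_X_three, jet3_comulLeft, jet3_swap12, jet3_comulRight, jet3_inclRight,
    smul_eq_mul, zero_add, zero_mul] at e
  split_ifs at e ⊢ with h1 h2 <;> linear_combination e

theorem shift_eq (h : IsIntertwiner l1 κ1 l3 κ3 l2 κ2 F) (j l : ℕ) :
    (κ2 - κ1 - κ3) * jet2 κ1 κ3 j l F = 0 := by
  have e := h.jet3_eq 0 j l
  simp at e
  linear_combination -e

/-- Order one in `x`: Euler's equation for homogeneous functions, read on derivatives. -/
theorem weight_eq (h : IsIntertwiner l1 κ1 l3 κ3 l2 κ2 F) (j l : ℕ) :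
    (l1 + l3 - l2 - (j + l : ℕ)) * jet2 κ1 κ3 j l F = 0 := by
  have e := h.jet3_eq 1 j l
  rcases j with _ | j <;> rcases l with _ | l <;>
    simp [add_comm 1, -mul_eq_zero] at e ⊢ <;> linear_combination e

/-- Order `r + 2` in `x`, where the term with `λ₂` has disappeared. -/
theorem recurrence (h : IsIntertwiner l1 κ1 l3 κ3 l2 κ2 F) (r j l : ℕ) :
    ((r + 2) * l1 - j) * jet2 κ1 κ3 (j + r + 1) l F +
      ((r + 2) * l3 - l) * jet2 κ1 κ3 j (l + r + 1) F = 0 := by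
  have e := h.jet3_eq (r + 2) j l
  rw [show r + 2 - 1 + j = j + r + 1 by omega, show r + 2 - 1 + l = l + r + 1 by omega] at e
  rcases j with _ | j <;> rcases l with _ | l <;> simp at e ⊢
  · linear_combination e
  · rw [show r + 2 + l = l + 1 + r + 1 by omega] at e
    linear_combination e
  · rw [show r + 2 + j = j + 1 + r + 1 by omega] at e
    linear_combination e
  · rw [show r + 2 + j = j + 1 + r + 1 by omega, show r + 2 + l = l + 1 + r + 1 by omega] at e
    linear_combination e

/-- A nonzero intertwiner is homogeneous about `(κ₁, κ₃)`. -/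
theorem exists_degree (h : IsIntertwiner l1 κ1 l3 κ3 l2 κ2 F) (hF : F ≠ 0) :
    ∃ N : ℕ, κ2 = κ1 + κ3 ∧ l2 = l1 + l3 - N ∧ ∀ i j, i + j ≠ N → jet2 κ1 κ3 i j F = 0 := by
  obtain ⟨i, j, hij⟩ : ∃ i j, jet2 κ1 κ3 i j F ≠ 0 := by
    by_contra! h0
    exact hF (H2.eq_zero_of_jet2 κ1 κ3 F h0)
  have h1 := (mul_eq_zero.mp (h.shift_eq i j)).resolve_right hij
  have h2 := (mul_eq_zero.mp (h.weight_eq i j)).resolve_right hij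
  refine ⟨i + j, by linear_combination h1, by linear_combination -h2, fun i' j' h' => ?_⟩
  refine (mul_eq_zero.mp (h.weight_eq i' j')).resolve_left fun h3 => h' ?_
  have : ((i' + j' : ℕ) : k) = (i + j : ℕ) := by linear_combination h2 - h3
  exact_mod_cast this

end IsIntertwiner

/-- The recurrence satisfied by the partial derivatives of an intertwiner has no solution of
degree `n + 4` with `l₁ ≠ 0` and `l₃ = 0`. -/
theorem recurrence_eq_zero_of_right {c : ℕ → ℕ → k} (hl1 : l1 ≠ 0)
    (h : ∀ r j l : ℕ, ((r + 2) * l1 - j) * c (j + r + 1) l +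
      (-(l : k)) * c j (l + r + 1) = 0) (n : ℕ) :
    ∀ i j, i + j = n + 4 → c i j = 0 := by
  have top : c (n + 4) 0 = 0 := by
    have := h (n + 3) 0 0
    simp only [Nat.cast_zero, neg_zero, zero_mul, add_zero, sub_zero, zero_add] at this
    refine (mul_eq_zero.mp this).resolve_left (mul_ne_zero ?_ hl1)
    exact_mod_cast (n + 3 + 1).succ_ne_zero
  -- The relations whose first index is `0` express all other entries through `c 0 (n + 4)`; two
  -- further relations then overdetermine `l₁`.
  have rel (j l : ℕ) (hjl : j + l = n + 3) :
      (j + 2) * l1 * c (j + 1) l = l * c 0 (n + 4) := by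
    have e := h j 0 l
    rw [show l + j + 1 = n + 4 by omega, show 0 + j + 1 = j + 1 by omega] at e
    push_cast at e
    linear_combination e
  have bottom : c 0 (n + 4) = 0 := by
    by_contra h0
    have e1 := rel 0 (n + 3) (by omega)
    have e2 := rel 1 (n + 2) (by omega)
    have e3 := h 0 1 (n + 2)
    have e4 := rel (n + 2) 1 (by omega)
    have e5 := rel (n + 1) 2 (by omega)
    have e6 := h 0 (n + 2) 1
    rw [show n + 2 + 0 + 1 = n + 3 by omega] at e3
    rw [show n + 2 + 0 + 1 = n + 3 by omega] at e6
    simp only [zero_add, add_zero, Nat.reduceAdd, add_assoc] at e1 e2 e3 e4 e5 e6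
    push_cast at e1 e2 e3 e4 e5 e6
    have n0 : (n : k) + 2 ≠ 0 := by exact_mod_cast (n + 1).succ_ne_zero
    have n1 : (n : k) + 1 ≠ 0 := by exact_mod_cast n.succ_ne_zero
    have n3 : (n : k) + 3 ≠ 0 := by exact_mod_cast (n + 2).succ_ne_zero
    have n4 : (n : k) + 4 ≠ 0 := by exact_mod_cast (n + 3).succ_ne_zero
    have n5 : (n : k) + 5 ≠ 0 := by exact_mod_cast (n + 4).succ_ne_zero
    -- both relations determine `2 l₁`
    have a1 : (n + 2) * (2 * (2 * l1 - 1) - 3 * (n + 3)) * c 0 (n + 4) = 0 := by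
      linear_combination 6 * l1 * e3 - 2 * (2 * l1 - 1) * e2 + 3 * (n + 2) * e1
    have a2 : ((2 * l1 - (n + 2)) * (n + 3) - 2 * (n + 4)) * c 0 (n + 4) = 0 := by
      linear_combination (n + 3) * (n + 4) * l1 * e6 - (2 * l1 - (n + 2)) * (n + 3) * e4 +
        (n + 4) * e5
    have b1 := (mul_eq_zero.mp ((mul_eq_zero.mp a1).resolve_right h0)).resolve_left n0
    have b2 := (mul_eq_zero.mp a2).resolve_right h0
    -- The factor `n + 1` would vanish in degree `3`, that is at `n = -1`, where a solution does
    -- exist.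
    have : ((n : k) + 1) * (n + 5) = 0 := by
      linear_combination 2 * b2 - (n + 3) * b1
    exact mul_ne_zero n1 n5 this
  intro i j hij
  rcases i with _ | i
  · rw [zero_add] at hij; rw [hij, bottom]
  · have e := rel i j (by omega)
    rw [bottom, mul_zero] at e
    refine (mul_eq_zero.mp e).resolve_left (mul_ne_zero ?_ hl1)
    exact_mod_cast (i + 1).succ_ne_zero

theorem recurrence_eq_zero {c : ℕ → ℕ → k}
    (h : ∀ r j l : ℕ, ((r + 2) * l1 - j) * c (j + r + 1) l +
      ((r + 2) * l3 - l) * c j (l + r + 1) = 0) (n : ℕ) :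
    ∀ i j, i + j = n + 4 → c i j = 0 := by
  by_cases hl3 : l3 = 0
  · subst hl3
    by_cases hl1 : l1 = 0
    · subst hl1
      have h' (r j l : ℕ) : j * c (j + r + 1) l + l * c j (l + r + 1) = 0 := by
        linear_combination -h r j l
      have left : c 0 (n + 4) = 0 := by
        have e := h' 0 0 (n + 3)
        simp only [Nat.cast_zero, zero_mul, zero_add] at e
        refine (mul_eq_zero.mp e).resolve_left ?_
        exact_mod_cast (n + 2).succ_ne_zero
      have right : c (n + 4) 0 = 0 := by
        have e := h' 0 (n + 3) 0
        simp only [Nat.cast_zero, zero_mul, add_zero] at e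
        refine (mul_eq_zero.mp e).resolve_left ?_
        exact_mod_cast (n + 2).succ_ne_zero
      -- With both weights zero the two end entries vanish and the relations with `j = 1` reduce the
      -- rest to `c 1 (n + 3)`.
      have rel (r l : ℕ) (hr : r + l = n + 2) : c (r + 2) l + l * c 1 (n + 3) = 0 := by
        have e := h' r 1 l
        rw [show 1 + r + 1 = r + 2 by omega, show l + r + 1 = n + 3 by omega] at e
        simpa using e
      have one : c 1 (n + 3) = 0 := by
        have e1 := rel 0 (n + 2) (by omega)
        have e2 := rel 1 (n + 1) (by omega)
        have e3 := h' 0 2 (n + 1)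
        simp only [zero_add, add_zero, Nat.reduceAdd, add_assoc] at e1 e2 e3
        push_cast at e1 e2 e3
        have : ((n : k) + 1) * (n + 4) * c 1 (n + 3) = 0 := by
          linear_combination 2 * e2 + (n + 1) * e1 - e3
        refine (mul_eq_zero.mp this).resolve_left (mul_ne_zero ?_ ?_)
        · exact_mod_cast n.succ_ne_zero
        · exact_mod_cast (n + 3).succ_ne_zero
      intro i j hij
      rcases i with _ | _ | i
      · rw [zero_add] at hij; rw [hij, left]
      · rw [show j = n + 3 by omega]; exact one
      · have e := rel i j (by omega)
        rw [one, mul_zero, add_zero] at e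
        exact e
    · exact recurrence_eq_zero_of_right hl1 (fun r j l => by simpa using h r j l) n
  · by_cases hl1 : l1 = 0
    · subst hl1
      intro i j hij
      refine recurrence_eq_zero_of_right (c := fun i j => c j i) hl3 (fun r j l => ?_) n j i
        (by omega)
      linear_combination h r l j
    -- With both weights nonzero, `relL` computes entries from `c 0 (n + 4)` and `relR` from `c (n +
    -- 4) 0`; the two ways must agree.
    · have relL (r l : ℕ) (hr : r + l = n + 3) :
          (r + 2) * l1 * c (r + 1) l + ((r + 2) * l3 - l) * c 0 (n + 4) = 0 := by
        have e := h r 0 l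
        rw [show l + r + 1 = n + 4 by omega, show 0 + r + 1 = r + 1 by omega] at e
        simpa using e
      have relR (r j : ℕ) (hr : r + j = n + 3) :
          ((r + 2) * l1 - j) * c (n + 4) 0 + (r + 2) * l3 * c j (r + 1) = 0 := by
        have e := h r j 0
        rw [show j + r + 1 = n + 4 by omega, show 0 + r + 1 = r + 1 by omega] at e
        simpa using e
      have n5 : (n : k) + 5 ≠ 0 := by exact_mod_cast (n + 4).succ_ne_zero
      have n4 : (n : k) + 4 ≠ 0 := by exact_mod_cast (n + 3).succ_ne_zero
      have n3 : (n : k) + 3 ≠ 0 := by exact_mod_cast (n + 2).succ_ne_zero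
      have n6 : (n : k) + 6 ≠ 0 := by exact_mod_cast (n + 5).succ_ne_zero
      have n1 : (n : k) + 1 ≠ 0 := by exact_mod_cast n.succ_ne_zero
      have top : c (n + 4) 0 = 0 := by
        by_contra h0
        have e0 := relR (n + 3) 0 (by omega)
        have e1 := relR (n + 2) 1 (by omega)
        have e2 := relR (n + 1) 2 (by omega)
        have f1 := relL 0 (n + 3) (by omega)
        have f2 := relL 1 (n + 2) (by omega)
        simp only [zero_add, Nat.reduceAdd, add_assoc] at e0 e1 e2 f1 f2
        push_cast at e0 e1 e2 f1 f2
        have g0 : l1 * c (n + 4) 0 + l3 * c 0 (n + 4) = 0 := by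
          apply mul_left_cancel₀ n5
          linear_combination e0
        -- Comparing the two values of `c 1 (n + 3)`, and in `g2` those of `c 2 (n + 2)`, prescribes
        -- `l₁ + l₃` twice; the prescriptions are incompatible.
        have g1 : (2 * (n + 4) * (l1 + l3) - 2 - (n + 3) * (n + 4)) * (l1 * c (n + 4) 0) = 0 := by
          linear_combination 2 * l1 * e1 - (n + 4) * l3 * f1 +
            (n + 4) * (2 * l3 - (n + 3)) * g0
        have g2 : (3 * (n + 3) * (l1 + l3) - 6 - (n + 2) * (n + 3)) * (l1 * c (n + 4) 0) = 0 := by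
          linear_combination 3 * l1 * e2 - (n + 3) * l3 * f2 +
            (n + 3) * (3 * l3 - (n + 2)) * g0
        have p1 := (mul_eq_zero.mp g1).resolve_right (mul_ne_zero hl1 h0)
        have p2 := (mul_eq_zero.mp g2).resolve_right (mul_ne_zero hl1 h0)
        have : ((n : k) + 1) * ((n + 5) * (n + 6)) = 0 := by
          linear_combination 2 * (n + 4) * p2 - 3 * (n + 3) * p1
        exact mul_ne_zero n1 (mul_ne_zero n5 n6) this
      intro i j hij
      rcases j with _ | j
      · rw [add_zero] at hij; rw [hij, top]
      · have e := relR j i (by omega)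
        rw [top, mul_zero, zero_add] at e
        refine (mul_eq_zero.mp e).resolve_left (mul_ne_zero ?_ hl3)
        exact_mod_cast (j + 1).succ_ne_zero

end Intertwiner

/-! ### Solutions of degree at most three: the lists for `α'` and `η₁₂` -/

section Classification

variable {k : Type*} [Field k]

@[simp] theorem eval_dp (n : ℕ) (x : k) : (dp n : k[X]).eval x = (n.factorial : k)⁻¹ * x ^ n := by
  simp [dp]

theorem jet2_swap (a b : k) (i j : ℕ) (F : H2 k) :
    jet2 a b i j (swap k F) = jet2 b a j i F := by
  change jet2 a b i j (swapK k F) = _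
  induction F using H2.induction with
  | zero => simp
  | tens f g => simp [swapK_tens, mul_comm]
  | add F G hF hG => simp only [map_add, hF, hG]

variable [CharZero k] {l1 κ1 l3 κ3 l2 κ2 : k} {F : H2 k}

/-- A nonzero intertwiner is homogeneous about `(κ₁, κ₃)` of degree at most three. -/
theorem IsIntertwiner.exists_degree_le_three (h : IsIntertwiner l1 κ1 l3 κ3 l2 κ2 F)
    (hF : F ≠ 0) :
    ∃ N : ℕ, (N = 0 ∨ N = 1 ∨ N = 2 ∨ N = 3) ∧ κ2 = κ1 + κ3 ∧ l2 = l1 + l3 - N ∧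
      (∀ i j, i + j ≠ N → jet2 κ1 κ3 i j F = 0) ∧
      ∀ x y, ev2 x y F = ∑ i ∈ Finset.range (N + 1), jet2 κ1 κ3 i (N - i) F *
        ((i.factorial : k)⁻¹ * (x - κ1) ^ i *
          (((N - i).factorial : k)⁻¹ * (y - κ3) ^ (N - i))) := by
  obtain ⟨N, hκ, hl, hN⟩ := h.exists_degree hF
  refine ⟨N, ?_, hκ, hl, hN, H2.eq_sum_of_jet2 κ1 κ3 N F hN⟩
  by_contra hN3
  obtain ⟨n, rfl⟩ : ∃ n, N = n + 4 := ⟨N - 4, by omega⟩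
  refine hF (H2.eq_zero_of_jet2 κ1 κ3 F fun i j => ?_)
  by_cases hij : i + j = n + 4
  · exact recurrence_eq_zero (c := fun i j => jet2 κ1 κ3 i j F) (fun r j l => h.recurrence r j l) n i j hij
  · exact hN i j hij

/-- Skew-symmetric intertwiners. -/
theorem alpha_cases (d : Coeffs k) (h : IsIntertwiner d.l1 d.k1 d.l1 d.k1 d.l2 d.k2 d.alpha)
    (hs : d.alpha = -swap k d.alpha) (h0 : d.alpha ≠ 0) :
    d.IsAlpha1 ∨ d.IsAlpha2 ∨ d.IsAlpha2' ∨ d.IsAlpha3 := by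
  obtain ⟨N, hN, hκ, hl, hz, hT⟩ := h.exists_degree_le_three h0
  have hsk (i j : ℕ) : jet2 d.k1 d.k1 i j d.alpha = -jet2 d.k1 d.k1 j i d.alpha := by
    conv_lhs => rw [hs]
    rw [map_neg, jet2_swap]
  have hdiag (i : ℕ) : jet2 d.k1 d.k1 i i d.alpha = 0 := by
    have := hsk i i
    linear_combination (1 / 2 : k) * this
  have hne : ¬ ∀ i j, jet2 d.k1 d.k1 i j d.alpha = 0 :=
    fun h => h0 (H2.eq_zero_of_jet2 d.k1 d.k1 _ h)
  have hrec := h.recurrence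
  -- From here on only the recurrence, homogeneity and skew-symmetry of the array of derivatives are
  -- used.
  generalize hc : (fun i j => jet2 d.k1 d.k1 i j d.alpha) = c at *
  have hc' (i j : ℕ) : jet2 d.k1 d.k1 i j d.alpha = c i j := congrFun₂ hc i j
  simp only [hc'] at *
  have hk : d.k2 = 2 * d.k1 := by rw [hκ]; ring
  rcases hN with rfl | rfl | rfl | rfl
  · refine absurd (fun i j => ?_) hne
    by_cases hij : i + j = 0
    · rw [show i = 0 by omega, show j = 0 by omega, hdiag]
    · exact hz i j hij
  · refine Or.inl ⟨by rw [hl]; push_cast; ring, hk, c 0 1, fun h1 => hne fun i j => ?_, ?_⟩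
    · by_cases hij : i + j = 1
      · obtain ⟨rfl, rfl⟩ | ⟨rfl, rfl⟩ : i = 0 ∧ j = 1 ∨ i = 1 ∧ j = 0 := by omega
        · exact h1
        · rw [hsk, h1, neg_zero]
      · exact hz i j hij
    · refine H2.ext_ev2 fun x y => ?_
      rw [hT]
      simp [Finset.sum_range_succ, hsk 1 0]
      ring
  -- Skew-symmetry removes `c 1 1`, leaving `(2λ₁ - 1) c 2 0 = 0`.
  · have e := hrec 0 1 0
    simp [hsk 2 0, hdiag] at e
    have h02 : c 0 2 ≠ 0 := fun h1 => hne fun i j => by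
      by_cases hij : i + j = 2
      · obtain ⟨rfl, rfl⟩ | ⟨rfl, rfl⟩ | ⟨rfl, rfl⟩ :
          i = 0 ∧ j = 2 ∨ i = 1 ∧ j = 1 ∨ i = 2 ∧ j = 0 := by omega
        · exact h1
        · exact hdiag 1
        · rw [hsk, h1, neg_zero]
      · exact hz i j hij
    have e1 := e.resolve_right h02
    have hl1 : d.l1 = 1 / 2 := by linear_combination (1 / 2 : k) * e1
    refine Or.inr (Or.inr (Or.inl ⟨hl1, by rw [hl, hl1]; norm_num, hk, c 0 2, h02, ?_⟩))
    refine H2.ext_ev2 fun x y => ?_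
    rw [hT]
    simp [Finset.sum_range_succ, hsk 2 0, hdiag, Nat.factorial]
    ring
  · have e1 := hrec 0 0 2
    have e2 := hrec 1 0 1
    simp only [zero_add, Nat.reduceAdd, hsk 2 1, CharP.cast_eq_zero, Nat.cast_one,
      Nat.cast_ofNat] at e1 e2
    have hex : ¬ (c 0 3 = 0 ∧ c 1 2 = 0) := fun ⟨h1, h2⟩ => hne fun i j => by
      by_cases hij : i + j = 3
      · obtain ⟨rfl, rfl⟩ | ⟨rfl, rfl⟩ | ⟨rfl, rfl⟩ | ⟨rfl, rfl⟩ :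
          i = 0 ∧ j = 3 ∨ i = 1 ∧ j = 2 ∨ i = 2 ∧ j = 1 ∨ i = 3 ∧ j = 0 := by omega
        · exact h1
        · exact h2
        · rw [hsk, h2, neg_zero]
        · rw [hsk, h1, neg_zero]
      · exact hz i j hij
    -- Eliminating `c 1 2` separates the case `c 0 3 = 0`, which gives `α'₂`, from `λ₁ = 2/3`, which
    -- gives `α'₃`.
    have e3 : (6 * d.l1 - 4) * c 0 3 = 0 := by linear_combination 3 / 2 * e1 + e2
    by_cases h03 : c 0 3 = 0
    · have h12 : c 1 2 ≠ 0 := fun h12 => hex ⟨h03, h12⟩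
      have hl1 : d.l1 = 0 := by
        have : d.l1 * c 1 2 = 0 := by rw [h03] at e1; linear_combination e1 / 2
        exact (mul_eq_zero.mp this).resolve_right h12
      refine Or.inr (Or.inl ⟨hl1, by rw [hl, hl1]; norm_num, hk, c 1 2, h12, ?_⟩)
      refine H2.ext_ev2 fun x y => ?_
      rw [hT]
      simp [Finset.sum_range_succ, hsk 3 0, hsk 2 1, h03, Nat.factorial]
      ring
    · have hl1 : d.l1 = 2 / 3 := by
        linear_combination (1 / 6 : k) * (mul_eq_zero.mp e3).resolve_right h03
      have h12 : c 1 2 = c 0 3 / 2 := by rw [hl1] at e1; linear_combination 3 / 4 * e1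
      refine Or.inr (Or.inr (Or.inr ⟨hl1, by rw [hl, hl1]; norm_num, hk, c 0 3, h03, ?_⟩))
      refine H2.ext_ev2 fun x y => ?_
      rw [hT]
      simp [Finset.sum_range_succ, hsk 3 0, hsk 2 1, h12, Nat.factorial]
      ring

/-- The possible values of `η₁₂`. -/
theorem eta12_cases (d : Coeffs k) (hC : d.Common)
    (h : IsIntertwiner d.l1 d.k1 d.l3 d.k3 d.l2 d.k2 d.eta12) (h0 : d.eta12 ≠ 0) :
    d.E1 ∨ d.E2 ∨ d.E3 ∨ d.E4 ∨ d.E5 ∨ d.E6 ∨ d.E7 ∨ d.E8 ∨ d.E9 ∨ d.E10 ∨ d.E11 ∨ d.E12 ∨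
      d.E13 := by
  obtain ⟨N, hN, hκ, hl, hz, hT⟩ := h.exists_degree_le_three h0
  have hne : ¬ ∀ i j, jet2 d.k1 d.k3 i j d.eta12 = 0 :=
    fun h => h0 (H2.eq_zero_of_jet2 d.k1 d.k3 _ h)
  have hrec := h.recurrence
  generalize hc : (fun i j => jet2 d.k1 d.k3 i j d.eta12) = c at *
  have hc' (i j : ℕ) : jet2 d.k1 d.k3 i j d.eta12 = c i j := congrFun₂ hc i j
  simp only [hc'] at *
  have hk : d.k3 = d.k2 - d.k1 := by rw [hκ]; ring
  -- `E4`, `E5` and `E7` are never selected: the first two are special cases of `E3` with `λ₁ = 0`,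
  -- the last is `E6` with `b₀₁ = 0`.
  rcases hN with rfl | rfl | rfl | rfl
  · refine Or.inr (Or.inl ⟨hC, by rw [hl]; push_cast; ring, hk, c 0 0,
      H2.ext_ev2 fun x y => ?_⟩)
    rw [hT]
    simp
  · have e := hrec 0 0 0
    simp at e
    by_cases h10 : c 1 0 = 0
    · have h01 : c 0 1 ≠ 0 := fun h01 => hne fun i j => by
        by_cases hij : i + j = 1
        · obtain ⟨rfl, rfl⟩ | ⟨rfl, rfl⟩ : i = 0 ∧ j = 1 ∨ i = 1 ∧ j = 0 := by omega
          · exact h01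
          · exact h10
        · exact hz i j hij
      have hl3 : d.l3 = 0 := by
        simpa [h10, h01] using e
      refine Or.inl ⟨hC, by rw [hl, hl3]; push_cast; ring, hκ, hl3, c 0 1,
        H2.ext_ev2 fun x y => ?_⟩
      rw [hT]
      simp [Finset.sum_range_succ, h10]
      ring
    · have hl3 : d.l3 = d.l2 - d.l1 + 1 := by rw [hl]; push_cast; ring
      refine Or.inr (Or.inr (Or.inr (Or.inr (Or.inr (Or.inl ⟨hC, hl3, hk, c 1 0, c 0 1, h10,
        ?_, H2.ext_ev2 fun x y => ?_⟩)))))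
      · rw [← hl3]
        linear_combination e / 2
      · rw [hT]
        simp [Finset.sum_range_succ, hk]
        ring
  · have e0 := hrec 0 0 1
    have e1 := hrec 0 1 0
    have e2 := hrec 1 0 0
    simp only [zero_add, Nat.reduceAdd, CharP.cast_eq_zero, Nat.cast_one] at e0 e1 e2
    push_cast at hl
    by_cases hl3 : d.l3 = 0
    · have h20 : c 2 0 = 0 := by
        rw [hl3] at e1 e2
        linear_combination 2 / 3 * e2 - e1
      have h02 : c 0 2 = 2 * d.l1 * c 1 1 := by
        rw [hl3] at e0
        linear_combination -e0
      refine Or.inr (Or.inr (Or.inl ⟨hC, by rw [hl, hl3]; ring, hl3, hk, c 1 1,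
        H2.ext_ev2 fun x y => ?_⟩))
      rw [hT]
      simp [Finset.sum_range_succ, Nat.factorial, h20, h02, hk]
      ring
    -- For `λ₃ ≠ 0` the relations with `l = 0` determine everything from `c 2 0`; the remaining
    -- relation constrains the weights.
    · have h02 : c 0 2 = -d.l1 * c 2 0 / d.l3 := by
        field_simp; linear_combination e2 / 3
      have h11 : c 1 1 = (1 - 2 * d.l1) * c 2 0 / (2 * d.l3) := by
        field_simp; linear_combination e1
      have h20 : c 2 0 ≠ 0 := fun h20 => hne fun i j => by
        by_cases hij : i + j = 2
        · obtain ⟨rfl, rfl⟩ | ⟨rfl, rfl⟩ | ⟨rfl, rfl⟩ :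
            i = 0 ∧ j = 2 ∨ i = 1 ∧ j = 1 ∨ i = 2 ∧ j = 0 := by omega
          · rw [h02, h20]; simp
          · rw [h11, h20]; simp
          · exact h20
        · exact hz i j hij
      have e3 : d.l1 * (d.l1 + d.l3 - 1) * c 2 0 = 0 := by
        rw [h02, h11] at e0
        field_simp at e0
        linear_combination -e0 / 4
      rcases mul_eq_zero.mp ((mul_eq_zero.mp e3).resolve_right h20) with hl1 | hl1
      · have hl2 : d.l2 + 2 = d.l3 := by rw [hl, hl1]; ring
        refine Or.inr (Or.inr (Or.inr (Or.inr (Or.inr (Or.inr (Or.inr (Or.inl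
          ⟨hC, hl1, fun h' => hl3 (by rw [← hl2, h']; ring), hl2.symm, hk, c 2 0,
          H2.ext_ev2 fun x y => ?_⟩)))))))
        rw [hT]
        simp only [Finset.sum_range_succ, Finset.sum_range_zero, h02, h11, hl1, hl2]
        simp [Nat.factorial, hk]
        field_simp
        ring
      · have hl3' : d.l3 = 1 - d.l1 := by linear_combination hl1
        have hl1' : 1 - d.l1 ≠ 0 := by rw [← hl3']; exact hl3
        refine Or.inr (Or.inr (Or.inr (Or.inr (Or.inr (Or.inr (Or.inr (Or.inr (Or.inl
          ⟨hC, fun h' => hl1' (by rw [h']; ring), by rw [hl, hl3']; ring, hl3', hk, c 2 0,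
          H2.ext_ev2 fun x y => ?_⟩))))))))
        rw [hT]
        simp only [Finset.sum_range_succ, Finset.sum_range_zero, h02, h11, hl3']
        have a1 : 2 - 2 * d.l1 = 2 * (1 - d.l1) := by ring
        have a2 : 2 * d.l1 - 2 = -(2 * (1 - d.l1)) := by ring
        simp [Nat.factorial, hk, a1, a2]
        field_simp
        ring
  · have e0 := hrec 0 0 2
    have e1 := hrec 0 1 1
    have e2 := hrec 0 2 0
    have e3 := hrec 1 0 1
    have e4 := hrec 1 1 0
    have e5 := hrec 2 0 0
    simp only [zero_add, Nat.reduceAdd, CharP.cast_eq_zero, Nat.cast_one, Nat.cast_ofNat]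
      at e0 e1 e2 e3 e4 e5
    push_cast at hl
    by_cases hl3 : d.l3 = 0
    · rw [hl3] at e0 e1 e2 e3 e4 e5
      have h30 : c 3 0 = 0 := by
        linear_combination 3 / 4 * e5 - e4
      have h12 : c 1 2 = (2 * d.l1 - 1) * c 2 1 := by linear_combination -e1
      have h03 : c 0 3 = 3 * d.l1 * c 2 1 := by linear_combination -e3
      have h21 : c 2 1 ≠ 0 := fun h21 => hne fun i j => by
        by_cases hij : i + j = 3
        · obtain ⟨rfl, rfl⟩ | ⟨rfl, rfl⟩ | ⟨rfl, rfl⟩ | ⟨rfl, rfl⟩ :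
            i = 0 ∧ j = 3 ∨ i = 1 ∧ j = 2 ∨ i = 2 ∧ j = 1 ∨ i = 3 ∧ j = 0 := by omega
          · rw [h03, h21, mul_zero]
          · rw [h12, h21, mul_zero]
          · exact h21
          · exact h30
        · exact hz i j hij
      have e6 : d.l1 * (d.l1 - 2) * c 2 1 = 0 := by
        rw [h12, h03] at e0
        linear_combination e0 / 4
      rcases mul_eq_zero.mp ((mul_eq_zero.mp e6).resolve_right h21) with hl1 | hl1
      · refine Or.inr (Or.inr (Or.inr (Or.inr (Or.inr (Or.inr (Or.inr (Or.inr (Or.inr (Or.inr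
          (Or.inr (Or.inl ⟨hC, hl1, by rw [hl, hl1, hl3]; ring, hl3, hk, c 2 1,
          H2.ext_ev2 fun x y => ?_⟩)))))))))))
        rw [hT]
        simp only [Finset.sum_range_succ, Finset.sum_range_zero, h03, h12, h30, hl1]
        simp [Nat.factorial, hk]
        field_simp
        ring
      · have hl1' : d.l1 = 2 := by linear_combination hl1
        refine Or.inr (Or.inr (Or.inr (Or.inr (Or.inr (Or.inr (Or.inr (Or.inr (Or.inr (Or.inr
          (Or.inr (Or.inr ⟨hC, hl1', by rw [hl, hl1', hl3]; ring, hl3, hk, c 2 1,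
          H2.ext_ev2 fun x y => ?_⟩)))))))))))
        rw [hT]
        simp only [Finset.sum_range_succ, Finset.sum_range_zero, h03, h12, h30, hl1']
        simp [Nat.factorial, hk]
        field_simp
        ring
    · have h03 : c 0 3 = -d.l1 * c 3 0 / d.l3 := by
        field_simp; linear_combination e5 / 4
      have h21 : c 2 1 = (1 - d.l1) * c 3 0 / d.l3 := by
        field_simp; linear_combination e2 / 2
      have h12 : c 1 2 = (1 - 3 * d.l1) * c 3 0 / (3 * d.l3) := by
        field_simp; linear_combination e4
      have h30 : c 3 0 ≠ 0 := fun h30 => hne fun i j => by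
        by_cases hij : i + j = 3
        · obtain ⟨rfl, rfl⟩ | ⟨rfl, rfl⟩ | ⟨rfl, rfl⟩ | ⟨rfl, rfl⟩ :
            i = 0 ∧ j = 3 ∨ i = 1 ∧ j = 2 ∨ i = 2 ∧ j = 1 ∨ i = 3 ∧ j = 0 := by omega
          · rw [h03, h30]; simp
          · rw [h12, h30]; simp
          · rw [h21, h30]; simp
          · exact h30
        · exact hz i j hij
      have e6 : d.l1 * (3 * (d.l1 + d.l3) - 4) * c 3 0 = 0 := by
        rw [h21, h03] at e3
        field_simp at e3
        linear_combination -e3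
      -- Together with `e6` this leaves only isolated weights: `λ₁ = 0` gives `λ₃ = 2`, and on `λ₁ +
      -- λ₃ = 4/3` the quadratic terms cancel, giving `λ₁ = 2/3`.
      have e7 : ((2 * d.l1 - 1) * (3 * (1 - d.l1)) + (2 * d.l3 - 1) * (1 - 3 * d.l1)) *
          c 3 0 = 0 := by
        rw [h21, h12] at e1
        field_simp at e1
        linear_combination e1
      have e8 := (mul_eq_zero.mp e7).resolve_right h30
      rcases mul_eq_zero.mp ((mul_eq_zero.mp e6).resolve_right h30) with hl1 | hl1
      · have hl3' : d.l3 = 2 := by rw [hl1] at e8; linear_combination e8 / 2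
        refine Or.inr (Or.inr (Or.inr (Or.inr (Or.inr (Or.inr (Or.inr (Or.inr (Or.inr
          (Or.inl ⟨hC, hl1, by rw [hl, hl1, hl3']; ring, hl3', hk, c 3 0,
          H2.ext_ev2 fun x y => ?_⟩)))))))))
        rw [hT]
        simp only [Finset.sum_range_succ, Finset.sum_range_zero, h03, h21, h12, hl1, hl3']
        simp [Nat.factorial, hk]
        field_simp
        ring
      · have hl3' : d.l3 = 4 / 3 - d.l1 := by linear_combination hl1 / 3
        have hl1' : d.l1 = 2 / 3 := by
          rw [hl3'] at e8
          linear_combination e8 / 2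
        have hl3'' : d.l3 = 2 / 3 := by rw [hl3', hl1']; norm_num
        refine Or.inr (Or.inr (Or.inr (Or.inr (Or.inr (Or.inr (Or.inr (Or.inr (Or.inr
          (Or.inr (Or.inl ⟨hC, hl1', by rw [hl, hl1', hl3'']; norm_num, hl3'', hk, c 3 0,
          H2.ext_ev2 fun x y => ?_⟩))))))))))
        rw [hT]
        simp only [Finset.sum_range_succ, Finset.sum_range_zero, h03, h21, h12, hl1', hl3'']
        simp [Nat.factorial, hk]
        field_simp
        ring

end Classification

/-! ## The Jacobi identity in coordinates -/

section Coordinates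

variable {k : Type*} [Field k] {L : Type*} [AddCommGroup L] [Module k[X] L]

theorem Pseudobracket.extLeft_tmul (p : Pseudobracket k L) (c : L) (F : H2 k) (a : L) :
    p.extLeft c (F ⊗ₜ[k[X]] a) =
      inclLeft k F • (comulLeft k).toLinearMap.rTensor L (p.br a c) := rfl

theorem Pseudobracket.extRight_tmul (p : Pseudobracket k L) (a : L) (F : H2 k) (b : L) :
    p.extRight a (F ⊗ₜ[k[X]] b) =
      inclRight k F • (comulRight k).toLinearMap.rTensor L (p.br a b) := rfl

/-- The coefficient of `e i` in an element of `A ⊗_H L`. -/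
noncomputable def coeffAt {ι : Type*} (e : Module.Basis ι k[X] L) (A : Type*) [CommRing A]
    [Algebra k[X] A] (i : ι) : A ⊗[k[X]] L →ₗ[k[X]] A :=
  (TensorProduct.rid k[X] A).toLinearMap ∘ₗ (e.coord i).lTensor A

theorem coeffAt_tmul {ι : Type*} [DecidableEq ι] (e : Module.Basis ι k[X] L) {A : Type*}
    [CommRing A] [Algebra k[X] A] (i j : ι) (a : A) :
    coeffAt e A i (a ⊗ₜ e j) = if j = i then a else 0 := by
  simp [coeffAt, Finsupp.single_apply]

variable {p : Pseudobracket k L} {e : Module.Basis (Fin 4) k[X] L} {d : Coeffs k}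

theorem HasBrackets.alpha_skew (hB : HasBrackets p e d) (hL : p.IsLie) :
    d.alpha = -swap k d.alpha := by
  have h := congrArg (coeffAt e _ 2) (hL.skew (e 1) (e 1))
  simpa [hB.b11, coeffAt_tmul] using h

theorem HasBrackets.alpha_intertwiner (hB : HasBrackets p e d) (hL : p.IsLie) :
    IsIntertwiner d.l1 d.k1 d.l1 d.k1 d.l2 d.k2 d.alpha := by
  have h := congrArg (coeffAt e _ 2) (hL.jacobi (e 0) (e 1) (e 1))
  simpa [hB.b11, hB.b01, hB.b02, Pseudobracket.extLeft_tmul, Pseudobracket.extRight_tmul,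
    TensorProduct.smul_tmul', coeffAt_tmul, IsIntertwiner] using h

theorem HasBrackets.eta11_intertwiner (hB : HasBrackets p e d) (hL : p.IsLie) :
    IsIntertwiner d.l1 d.k1 d.l3 d.k3 d.l1 d.k1 d.eta11 := by
  have h := congrArg (coeffAt e _ 1) (hL.jacobi (e 0) (e 1) (e 3))
  simpa [hB.b13, hB.b01, hB.b02, hB.b03, Pseudobracket.extLeft_tmul, Pseudobracket.extRight_tmul,
    TensorProduct.smul_tmul', coeffAt_tmul, IsIntertwiner] using h

theorem HasBrackets.eta12_intertwiner (hB : HasBrackets p e d) (hL : p.IsLie) :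
    IsIntertwiner d.l1 d.k1 d.l3 d.k3 d.l2 d.k2 d.eta12 := by
  have h := congrArg (coeffAt e _ 2) (hL.jacobi (e 0) (e 1) (e 3))
  simpa [hB.b13, hB.b01, hB.b02, hB.b03, Pseudobracket.extLeft_tmul, Pseudobracket.extRight_tmul,
    TensorProduct.smul_tmul', coeffAt_tmul, IsIntertwiner] using h

theorem HasBrackets.eta22_intertwiner (hB : HasBrackets p e d) (hL : p.IsLie) :
    IsIntertwiner d.l2 d.k2 d.l3 d.k3 d.l2 d.k2 d.eta22 := by
  have h := congrArg (coeffAt e _ 2) (hL.jacobi (e 0) (e 2) (e 3))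
  simpa [hB.b23, hB.b01, hB.b02, hB.b03, Pseudobracket.extLeft_tmul, Pseudobracket.extRight_tmul,
    TensorProduct.smul_tmul', coeffAt_tmul, IsIntertwiner] using h

/-- As `η = 0`, the terms `[e₁, [e₁, e₃]]` lie over `e₂` alone, so the left side of the Jacobi
identity has no `e₁`-part. -/
theorem HasBrackets.alpha_eta21 (hB : HasBrackets p e d) (hL : p.IsLie) (hη : d.eta = 0) :
    inclLeft k d.alpha * comulLeft k d.eta21 = 0 := by
  have h := congrArg (coeffAt e _ 1) (hL.jacobi (e 1) (e 1) (e 3))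
  simpa [hB.b11, hB.b12, hη, hB.b13, hB.b23, Pseudobracket.extLeft_tmul,
    Pseudobracket.extRight_tmul, TensorProduct.smul_tmul', coeffAt_tmul] using h

theorem HasBrackets.alpha_eta22 (hB : HasBrackets p e d) (hL : p.IsLie) (hη : d.eta = 0) :
    inclLeft k d.alpha * comulLeft k d.eta22 = inclRight k d.eta11 * comulRight k d.alpha -
      swap12 k (inclRight k d.eta11 * comulRight k d.alpha) := by
  have h := congrArg (coeffAt e _ 2) (hL.jacobi (e 1) (e 1) (e 3))
  simpa [hB.b11, hB.b12, hη, hB.b13, hB.b23, Pseudobracket.extLeft_tmul,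
    Pseudobracket.extRight_tmul, TensorProduct.smul_tmul', coeffAt_tmul] using h

/-- Because `[e₃, e₃] = 0`, the two actions of `e₃` commute: in values, `η₁₁(x, y) η₁₁(x+y, z)` is
symmetric in `y` and `z`. `HasBrackets.eta12_eta22` is the `e₂`-part of the same identity. -/
theorem HasBrackets.eta11_eta11 (hB : HasBrackets p e d) (hL : p.IsLie) (h21 : d.eta21 = 0) :
    inclLeft k d.eta11 * comulLeft k d.eta11 =
      swap12 k (inclRight k d.eta11 * comulRight k (swap k d.eta11)) := by
  have h := congrArg (coeffAt e _ 1) (hL.jacobi (e 1) (e 3) (e 3))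
  simpa [hL.skew (e 3) (e 1), hL.skew (e 3) (e 2), hB.b13, hB.b23, hB.b33, h21, Pseudobracket.extLeft_tmul,
    Pseudobracket.extRight_tmul, TensorProduct.smul_tmul', coeffAt_tmul] using h

theorem HasBrackets.eta12_eta22 (hB : HasBrackets p e d) (hL : p.IsLie) :
    inclLeft k d.eta11 * comulLeft k d.eta12 + inclLeft k d.eta12 * comulLeft k d.eta22 =
      swap12 k (inclRight k d.eta11 * comulRight k (swap k d.eta12) +
        inclRight k d.eta12 * comulRight k (swap k d.eta22)) := by
  have h := congrArg (coeffAt e _ 2) (hL.jacobi (e 1) (e 3) (e 3))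
  simp [hL.skew (e 3) (e 1), hL.skew (e 3) (e 2), hB.b13, hB.b23, hB.b33,
    Pseudobracket.extLeft_tmul, Pseudobracket.extRight_tmul, TensorProduct.smul_tmul',
    coeffAt_tmul] at h
  simp only [map_add, map_mul]
  linear_combination h

end Coordinates

/-! ### Consequences of the other Jacobi identities and the final case distinction -/

section MainClassification

variable {k : Type*} [Field k]

/-- The restriction of `F(x, y)` to `y = b`. -/
theorem H2.exists_restrict (F : H2 k) (b : k) :
    ∃ g : k[X], (∀ u, g.eval u = ev2 u b F) ∧ ∀ a i, jet a i g = jet2 a b i 0 F := by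
  induction F using H2.induction with
  | zero => exact ⟨0, by simp, by simp⟩
  | tens f h =>
    refine ⟨h.eval b • f, fun u => ?_, fun a i => ?_⟩
    · simp [mul_comm]
    · rw [map_smul, jet2_tens, jet_apply b, smul_eq_mul, mul_comm]; rfl
  | add F G hF hG =>
    obtain ⟨f, hf, hf'⟩ := hF
    obtain ⟨g, hg, hg'⟩ := hG
    exact ⟨f + g, by simp [hf, hg], by simp [hf', hg']⟩

variable [CharZero k]

/-- For fixed `z`, with `g = G(·, z)`, the hypothesis says `F · Δ g = 0` in the domain `H ⊗ H`. -/
theorem eq_zero_of_inclLeft_mul_comulLeft {F G : H2 k} (hF : F ≠ 0)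
    (h : inclLeft k F * comulLeft k G = 0) : G = 0 := by
  refine H2.eq_zero_of_ev2 G fun x z => ?_
  obtain ⟨g, hg, -⟩ := G.exists_restrict z
  have h0 : F * comul k g = 0 := by
    refine H2.eq_zero_of_ev2 _ fun x y => ?_
    have := congrArg (ev3 x y z) h
    simpa [hg] using this
  have := congrArg (ev2 x 0) ((H2.mul_eq_zero h0).resolve_left hF)
  simpa [hg] using this

/-- The weights force degree `l + 0 - l = 0`. -/
theorem IsIntertwiner.eq_smul_one {l κ : k} {F : H2 k} (h : IsIntertwiner l κ 0 0 l κ F) :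
    ∃ c : k, F = c • 1 ⊠ 1 := by
  by_cases hF : F = 0
  · exact ⟨0, by rw [hF, zero_smul]⟩
  obtain ⟨N, -, hl, hz⟩ := h.exists_degree hF
  have hN : N = 0 := by
    have : (N : k) = 0 := by linear_combination hl
    exact_mod_cast this
  subst hN
  refine ⟨jet2 κ 0 0 0 F, H2.ext_ev2 fun x y => ?_⟩
  rw [H2.eq_sum_of_jet2 κ 0 0 F hz]
  simp

/-- If `F(x, y) F(x + y, z)` is symmetric in `y` and `z` and `F` is a nonzero intertwiner, then
`F` is a scalar. -/
theorem IsIntertwiner.eq_smul_one_of_symm {l1 κ1 l3 κ3 : k} {F : H2 k}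
    (h : IsIntertwiner l1 κ1 l3 κ3 l1 κ1 F) (hF : F ≠ 0)
    (hs : ∀ x y z, ev2 x y F * ev2 (x + y) z F = ev2 x z F * ev2 (x + z) y F) :
    l3 = 0 ∧ κ3 = 0 ∧ ∃ a : k, a ≠ 0 ∧ F = a • 1 ⊠ 1 := by
  obtain ⟨N, hκ, hl, hz⟩ := h.exists_degree hF
  obtain rfl : κ3 = 0 := by linear_combination -hκ
  obtain ⟨g, hg, hgj⟩ := F.exists_restrict 0
  -- At `z = 0` the symmetry reads `F(x, y) g(x + y) = g(x) F(x, y)`, so `g` is invariant under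
  -- translation, hence constant.
  have h0 : F * (comul k g - g ⊠ 1) = 0 := by
    refine H2.eq_zero_of_ev2 _ fun x y => ?_
    have := hs x y 0
    simp only [map_mul, map_sub, ev2_comul, ev2_tens, eval_one, mul_one, hg]
    rw [add_zero] at this
    linear_combination this
  have hc (u : k) : g.eval u = g.eval 0 := by
    have := congrArg (ev2 0 u) ((H2.mul_eq_zero h0).resolve_left hF)
    simpa [sub_eq_zero] using this
  have hgC : g = C (g.eval 0) := Polynomial.funext fun u => by rw [hc u, eval_C]
  have hj (i : ℕ) : jet2 κ1 0 (i + 1) 0 F = 0 := by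
    rw [← hgj, hgC, jet_apply, iterate_derivative_C i.succ_pos, eval_zero]
  have hN : N = 0 := by
    by_contra hN
    have hl3 : l3 ≠ 0 := by
      rw [show l3 = N by linear_combination -hl]
      exact_mod_cast hN
    refine hF (H2.eq_zero_of_jet2 κ1 0 F fun i j => ?_)
    rcases j with _ | j
    · rcases i with _ | i
      · exact hz 0 0 (by omega)
      · exact hj i
    -- In positive degree all pure `x`-derivatives now vanish, and since `λ₃ = N ≠ 0` the relations
    -- with `l = 0` kill the others.
    · have e := h.recurrence j i 0
      rw [hj, mul_zero, zero_add, Nat.cast_zero, sub_zero, zero_add] at e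
      refine (mul_eq_zero.mp e).resolve_left (mul_ne_zero ?_ hl3)
      exact_mod_cast (j + 1).succ_ne_zero
  subst hN
  have hl3 : l3 = 0 := by push_cast at hl; linear_combination -hl
  subst hl3
  obtain ⟨a, ha⟩ := h.eq_smul_one
  exact ⟨rfl, rfl, a, fun h0 => hF (by rw [ha, h0, zero_smul]), ha⟩

/-- The only type of `α'` with `2 α'(x, y) = α'(x, y + z) - α'(y, x + z)`. -/
theorem isAlpha1_of_two_mul {d : Coeffs k}
    (h : d.IsAlpha1 ∨ d.IsAlpha2 ∨ d.IsAlpha2' ∨ d.IsAlpha3)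
    (h2 : ∀ x y z, 2 * ev2 x y d.alpha = ev2 x (y + z) d.alpha - ev2 y (x + z) d.alpha) :
    d.IsAlpha1 := by
  rcases h with h | ⟨-, -, -, w, hw, h⟩ | ⟨-, -, -, w, hw, h⟩ | ⟨-, -, -, w, hw, h⟩
  · exact h
  -- At `x = κ₁` only the leading homogeneous part of `α'` is seen. The point `y = κ₁ + 1`, which
  -- suffices in the next two cases, is useless here, because this form also vanishes on the
  -- diagonal.
  · have := h2 d.k1 (d.k1 + 2) 1
    rw [h] at this
    simp [Nat.factorial] at this
    exact absurd (by linear_combination -this) hw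
  · have := h2 d.k1 (d.k1 + 1) 1
    rw [h] at this
    simp [Nat.factorial] at this
    exact absurd (by linear_combination -this) hw
  · have := h2 d.k1 (d.k1 + 1) 1
    rw [h] at this
    simp [Nat.factorial] at this
    exact absurd (by linear_combination -this) hw

theorem last_cases {d : Coeffs k} {a w : k} (hC : d.CommonLast a w)
    (hl2 : d.l2 = 2 * d.l1 - 1) (hk2 : d.k2 = 2 * d.k1) (hl3 : d.l3 = 0) (hk3 : d.k3 = 0)
    (h : IsIntertwiner d.l1 d.k1 d.l3 d.k3 d.l2 d.k2 d.eta12)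
    (h2 : ∀ x y z, ev2 (x + y) z d.eta12 + 2 * ev2 x y d.eta12 =
      ev2 (x + z) y d.eta12 + 2 * ev2 x z d.eta12) :
    d.E14 ∨ d.E15 ∨ d.E16 := by
  by_cases h0 : d.eta12 = 0
  · exact Or.inl ⟨a, w, d.l1, d.k1, hC, h0, rfl, rfl, hl2, hk2, hl3, hk3⟩
  obtain ⟨N, hκ, hl, hz⟩ := h.exists_degree h0
  have hk1 : d.k1 = 0 := by linear_combination hκ - hk2 + hk3
  have hk2' : d.k2 = 0 := by rw [hk2, hk1, mul_zero]
  -- Combines `λ₂ = λ₁ + λ₃ - N` with `λ₂ = 2λ₁ - 1`; the degree alone fixes `λ₁`.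
  have hl1 : d.l1 = 1 - N := by linear_combination hl - hl2 + hl3
  have hT := H2.eq_sum_of_jet2 _ _ N d.eta12 hz
  -- The case `z = 0` of `h2`: `η₁₂` is determined by its restriction to `y = 0`.
  have hform (x y : k) : ev2 x y d.eta12 = 2 * ev2 x 0 d.eta12 - ev2 (x + y) 0 d.eta12 := by
    have := h2 x y 0
    rw [add_zero] at this
    linear_combination this
  obtain rfl | rfl | ⟨n, rfl⟩ : N = 0 ∨ N = 1 ∨ ∃ n, N = n + 2 := by
    rcases N with _ | _ | n
    · exact Or.inl rfl
    · exact Or.inr (Or.inl rfl)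
    · exact Or.inr (Or.inr ⟨n, rfl⟩)
  · have e : d.eta12 = jet2 d.k1 d.k3 0 0 d.eta12 • 1 ⊠ 1 :=
      H2.ext_ev2 fun x y => by rw [hT]; simp
    refine Or.inr (Or.inl ⟨a, w, _, hC, fun h1 => h0 ?_, e, by simp [hl1], hk1,
      by rw [hl2, hl1]; norm_num, hk2', hl3, hk3⟩)
    rw [e, h1, zero_smul]
  · have hT' (x y : k) : ev2 x y d.eta12 =
        jet2 d.k1 d.k3 0 1 d.eta12 * y + jet2 d.k1 d.k3 1 0 d.eta12 * x := by
      rw [hT]; simp [Finset.sum_range_succ, hk1, hk3]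
    have hs : jet2 d.k1 d.k3 0 1 d.eta12 = -jet2 d.k1 d.k3 1 0 d.eta12 := by
      have := hform 0 1
      simp only [hT'] at this
      linear_combination this
    have e : d.eta12 = jet2 d.k1 d.k3 1 0 d.eta12 • (dp 1 ⊠ 1 - 1 ⊠ dp 1) :=
      H2.ext_ev2 fun x y => by rw [hT', hs]; simp; ring
    refine Or.inr (Or.inr ⟨a, w, _, hC, fun h1 => h0 ?_, e, by simp [hl1], hk1,
      by rw [hl2, hl1]; norm_num, hk2', hl3, hk3⟩)
    rw [e, h1, zero_smul]
  -- For `N ≥ 2` one has `λ₁ = 1 - N ≠ 0` and `λ₃ = 0`, so the recurrence kills the only possible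
  -- derivative of the restriction, and `hform` gives `η₁₂ = 0`.
  · exfalso
    obtain ⟨g, hg, hgj⟩ := d.eta12.exists_restrict d.k3
    have hg0 : g = 0 := by
      refine eq_zero_of_jet d.k1 g fun i => ?_
      rw [hgj]
      by_cases hi : i = n + 2
      · have e := h.recurrence (n + 1) 0 0
        rw [hl1, hl3] at e
        push_cast at e
        simp only [sub_zero, mul_zero, zero_mul, add_zero, zero_add, add_assoc,
          Nat.reduceAdd] at e
        rw [hi]
        refine (mul_eq_zero.mp e).resolve_left (mul_ne_zero ?_ ?_)
        · norm_num
          exact_mod_cast (n + 2).succ_ne_zero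
        · rw [show (1 : k) - (n + 2) = -((n + 1 : ℕ) : k) by push_cast; ring]
          exact neg_ne_zero.mpr (by exact_mod_cast n.succ_ne_zero)
      · exact hz i 0 (by omega)
    rw [hk3] at hg
    refine h0 (H2.eq_zero_of_ev2 _ fun x y => ?_)
    rw [hform, ← hg, ← hg, hg0]
    simp

theorem HasBrackets.classification {L : Type*} [AddCommGroup L] [Module k[X] L]
    {p : Pseudobracket k L} {e : Module.Basis (Fin 4) k[X] L} {d : Coeffs k}
    (hB : HasBrackets p e d) (hL : p.IsLie)
    (hne : ¬ (d.eta11 = 0 ∧ d.eta12 = 0 ∧ d.eta21 = 0 ∧ d.eta22 = 0))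
    (hη : d.eta = 0) (hα : d.alpha ≠ 0) :
    (d.E1 ∨ d.E2 ∨ d.E3 ∨ d.E4 ∨ d.E5 ∨ d.E6 ∨ d.E7 ∨ d.E8 ∨ d.E9 ∨ d.E10 ∨ d.E11 ∨ d.E12 ∨
      d.E13) ∨ d.E14 ∨ d.E15 ∨ d.E16 := by
  have h21 : d.eta21 = 0 := eq_zero_of_inclLeft_mul_comulLeft hα (hB.alpha_eta21 hL hη)
  have hcases := alpha_cases d (hB.alpha_intertwiner hL) (hB.alpha_skew hL) hα
  have hskew (x y : k) : ev2 x y d.alpha = -ev2 y x d.alpha := by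
    conv_lhs => rw [hB.alpha_skew hL]
    simp
  have h113 (x y z : k) : ev2 x y d.alpha * ev2 (x + y) z d.eta22 =
      ev2 y z d.eta11 * ev2 x (y + z) d.alpha - ev2 x z d.eta11 * ev2 y (x + z) d.alpha := by
    simpa using congrArg (ev3 x y z) (hB.alpha_eta22 hL hη)
  by_cases h11 : d.eta11 = 0
  · have h22 : d.eta22 = 0 := by
      refine eq_zero_of_inclLeft_mul_comulLeft hα ?_
      rw [hB.alpha_eta22 hL hη, h11]
      simp
    have h12 : d.eta12 ≠ 0 := fun h12 => hne ⟨h11, h12, h21, h22⟩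
    exact Or.inl (eta12_cases d ⟨h11, h21, h22, hη, h12, hcases⟩ (hB.eta12_intertwiner hL) h12)
  · obtain ⟨hl3, hk3, a, ha, h11⟩ := (hB.eta11_intertwiner hL).eq_smul_one_of_symm h11
      fun x y z => by simpa using congrArg (ev3 x y z) (hB.eta11_eta11 hL h21)
    have h22 := hB.eta22_intertwiner hL
    rw [hl3, hk3] at h22
    obtain ⟨b, h22⟩ := h22.eq_smul_one
    simp only [h11, h22, map_smul, ev2_tens, eval_one, mul_one, smul_eq_mul] at h113
    obtain ⟨x, y, hxy⟩ : ∃ x y, ev2 x y d.alpha ≠ 0 := by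
      by_contra! h
      exact hα (H2.eq_zero_of_ev2 _ h)
    -- At `z = 0` skew-symmetry of `α'` turns the right side into `2a α'(x, y)`.
    have hb : b = 2 * a := by
      have := h113 x y 0
      rw [add_zero, add_zero, hskew y x] at this
      apply mul_left_cancel₀ hxy
      linear_combination this
    subst hb
    obtain ⟨hl2, hk2, w, hw, h1⟩ := isAlpha1_of_two_mul hcases fun x y z => by
      apply mul_left_cancel₀ ha
      linear_combination h113 x y z
    refine Or.inr (last_cases ⟨ha, h11, h22, h21, hη, hw, h1⟩ hl2 hk2 hl3 hk3
      (hB.eta12_intertwiner hL) fun x y z => ?_)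
    have := congrArg (ev3 x y z) (hB.eta12_eta22 hL)
    simp [h11, h22] at this
    apply mul_left_cancel₀ ha
    linear_combination this

end MainClassification

/-! ## Pseudobrackets given by structure constants -/

namespace Pseudobracket

variable {k : Type*} [Field k] {L : Type*} [AddCommGroup L] [Module k[X] L]

theorem tens_zero (f : k[X]) : f ⊠ (0 : k[X]) = 0 := TensorProduct.tmul_zero _ f

theorem br_zero_left (p : Pseudobracket k L) (b : L) : p.br 0 b = 0 := by
  simpa [zero_tens] using p.smul_left 0 0 b

theorem br_zero_right (p : Pseudobracket k L) (a : L) : p.br a 0 = 0 := by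
  simpa [tens_zero] using p.smul_right 0 a 0

theorem swap_smul (F : H2 k) (x : H2 k ⊗[k[X]] L) :
    (swap k).toLinearMap.rTensor L (F • x) = swap k F • (swap k).toLinearMap.rTensor L x := by
  induction x with
  | zero => simp
  | add x y hx hy => simp only [smul_add, map_add, hx, hy]
  | tmul G a => simp [TensorProduct.smul_tmul']

theorem swap12_smul (F : H3 k) (x : H3 k ⊗[k[X]] L) :
    (swap12 k).toLinearMap.rTensor L (F • x) =
      swap12 k F • (swap12 k).toLinearMap.rTensor L x := by
  induction x with
  | zero => simp
  | add x y hx hy => simp only [smul_add, map_add, hx, hy]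
  | tmul G a => simp [TensorProduct.smul_tmul']

theorem swap_tens (f g : k[X]) : swap k (f ⊠ g) = g ⊠ f := rfl

theorem swap12_tens3 (f g h : k[X]) : swap12 k (tens3 f g h) = tens3 g f h := rfl

theorem comulLeft_one_tens (f : k[X]) : comulLeft k (1 ⊠ f) = tens3 1 1 f := by
  change comulLeftK k (1 ⊠ f) = _
  rw [comulLeftK_tens, map_one, map_one, one_mul]

theorem comulRight_tens_one (f : k[X]) : comulRight k (f ⊠ 1) = tens3 f 1 1 := by
  change comulRightK k (f ⊠ 1) = _
  rw [comulRightK_tens, map_one, map_one, mul_one]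

theorem extLeft_smul (p : Pseudobracket k L) (c : L) (F : H2 k) (x : H2 k ⊗[k[X]] L) :
    p.extLeft c (F • x) = inclLeft k F • p.extLeft c x := by
  induction x with
  | zero => simp
  | add x y hx hy => simp only [smul_add, map_add, hx, hy]
  | tmul G a => simp [TensorProduct.smul_tmul', extLeft_tmul, smul_smul]

theorem extRight_smul (p : Pseudobracket k L) (a : L) (F : H2 k) (x : H2 k ⊗[k[X]] L) :
    p.extRight a (F • x) = inclRight k F • p.extRight a x := by
  induction x with
  | zero => simp
  | add x y hx hy => simp only [smul_add, map_add, hx, hy]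
  | tmul G a => simp [TensorProduct.smul_tmul', extRight_tmul, smul_smul]

theorem extLeft_smul_arg (p : Pseudobracket k L) (f : k[X]) (c : L) (x : H2 k ⊗[k[X]] L) :
    p.extLeft (f • c) x = tens3 1 1 f • p.extLeft c x := by
  induction x with
  | zero => simp
  | add x y hx hy => simp only [smul_add, map_add, hx, hy]
  | tmul G a =>
    rw [extLeft_tmul, extLeft_tmul, p.smul_right, comulLeft_smul, comulLeft_one_tens,
      smul_comm]

theorem extRight_smul_arg (p : Pseudobracket k L) (f : k[X]) (a : L) (x : H2 k ⊗[k[X]] L) :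
    p.extRight (f • a) x = tens3 f 1 1 • p.extRight a x := by
  induction x with
  | zero => simp
  | add x y hx hy => simp only [smul_add, map_add, hx, hy]
  | tmul G a =>
    rw [extRight_tmul, extRight_tmul, p.smul_left, comulRight_smul, comulRight_tens_one,
      smul_comm]

theorem extLeft_add_arg (p : Pseudobracket k L) (c c' : L) (x : H2 k ⊗[k[X]] L) :
    p.extLeft (c + c') x = p.extLeft c x + p.extLeft c' x := by
  induction x with
  | zero => simp
  | add x y hx hy => simp only [map_add, hx, hy]; abel
  | tmul G a => simp only [extLeft_tmul, p.add_right, map_add, smul_add]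

theorem extRight_add_arg (p : Pseudobracket k L) (a a' : L) (x : H2 k ⊗[k[X]] L) :
    p.extRight (a + a') x = p.extRight a x + p.extRight a' x := by
  induction x with
  | zero => simp
  | add x y hx hy => simp only [map_add, hx, hy]; abel
  | tmul G a => simp only [extRight_tmul, p.add_left, map_add, smul_add]

theorem extLeft_zero_arg (p : Pseudobracket k L) (x : H2 k ⊗[k[X]] L) : p.extLeft 0 x = 0 := by
  simpa using p.extLeft_add_arg 0 0 x

theorem extRight_zero_arg (p : Pseudobracket k L) (x : H2 k ⊗[k[X]] L) :
    p.extRight 0 x = 0 := by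
  simpa using p.extRight_add_arg 0 0 x

/-- The axioms of a Lie pseudoalgebra need to be checked on generators only. -/
theorem isLie_of_span (p : Pseudobracket k L) (S : Set L) (hS : Submodule.span k[X] S = ⊤)
    (skew : ∀ a ∈ S, ∀ b ∈ S, p.br a b = -(swap k).toLinearMap.rTensor L (p.br b a))
    (jacobi : ∀ a ∈ S, ∀ b ∈ S, ∀ c ∈ S, p.extLeft c (p.br a b) =
      p.extRight a (p.br b c) - (swap12 k).toLinearMap.rTensor L (p.extRight b (p.br a c))) :
    p.IsLie := by
  -- Span induction in each argument works because a scalar from `H` leaves every term as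
  -- multiplication by the same pure tensor, once the flips are accounted for.
  have mem (a : L) : a ∈ Submodule.span k[X] S := hS ▸ Submodule.mem_top
  constructor
  · intro a b
    induction mem a using Submodule.span_induction with
    | mem a ha =>
      induction mem b using Submodule.span_induction with
      | mem b hb => exact skew a ha b hb
      | zero => simp [br_zero_left, br_zero_right]
      | add x y _ _ hx hy => rw [p.add_right, p.add_left, hx, hy, map_add, neg_add]
      | smul f x _ hx =>
        rw [p.smul_right, p.smul_left, hx, swap_smul, swap_tens, smul_neg]
    | zero => simp [br_zero_left, br_zero_right]
    | add x y _ _ hx hy => rw [p.add_right, p.add_left, hx, hy, map_add, neg_add]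
    | smul f x _ hx =>
      rw [p.smul_right, p.smul_left, hx, swap_smul, swap_tens, smul_neg]
  · intro a b c
    induction mem a using Submodule.span_induction with
    | mem a ha =>
      induction mem b using Submodule.span_induction with
      | mem b hb =>
        induction mem c using Submodule.span_induction with
        | mem c hc => exact jacobi a ha b hb c hc
        | zero => simp [br_zero_right, extLeft_zero_arg]
        | add x y _ _ hx hy =>
          simp only [p.add_right, map_add, extLeft_add_arg, hx, hy]
          abel
        | smul f x _ hx =>
          rw [p.smul_right, p.smul_right, extLeft_smul_arg, extRight_smul, extRight_smul,
            swap12_smul, inclRight_tens, swap12_tens3, hx, smul_sub]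
      | zero => simp [br_zero_left, br_zero_right, extRight_zero_arg]
      | add x y _ _ hx hy =>
        simp only [p.add_right, p.add_left, map_add, extRight_add_arg, hx, hy]
        abel
      | smul f x _ hx =>
        rw [p.smul_right, p.smul_left, extRight_smul_arg, extRight_smul, extLeft_smul,
          swap12_smul, inclRight_tens, inclLeft_tens, swap12_tens3, hx, smul_sub]
    | zero => simp [br_zero_left, extRight_zero_arg]
    | add x y _ _ hx hy =>
      simp only [p.add_left, map_add, extRight_add_arg, hx, hy]
      abel
    | smul f x _ hx =>
      rw [p.smul_left, p.smul_left, extRight_smul_arg, extRight_smul, extLeft_smul,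
        swap12_smul, inclRight_tens, inclLeft_tens, swap12_tens3, hx, smul_sub]

end Pseudobracket

/-! ### Lie axioms expressed by structure constants -/

section StructureConstants

variable {k : Type*} [Field k] {n : ℕ} (c : Fin n → Fin n → Fin n → H2 k)

theorem ofStructureConstants_br_single (i j : Fin n) :
    (ofStructureConstants c).br (Pi.single i 1) (Pi.single j 1) =
      ∑ l, c i j l ⊗ₜ[k[X]] (Pi.single l 1 : Fin n → k[X]) := by
  change ∑ i', ∑ j', ∑ l, ((Pi.single i 1 : Fin n → k[X]) i' ⊠
    (Pi.single j 1 : Fin n → k[X]) j' * c i' j' l) ⊗ₜ[k[X]] (Pi.single l 1 : Fin n → k[X]) = _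
  rw [Finset.sum_eq_single i, Finset.sum_eq_single j]
  · simp [one_tens_one]
  · intro j' _ hj
    simp [Pi.single_eq_of_ne hj, Pseudobracket.tens_zero]
  · simp
  · intro i' _ hi
    simp [Pi.single_eq_of_ne hi, zero_tens]
  · simp

theorem ofStructureConstants_isLie (hskew : ∀ i j l, c i j l = -swap k (c j i l))
    (hjac : ∀ i j q m, ∑ l, inclLeft k (c i j l) * comulLeft k (c l q m) =
      ∑ l, inclRight k (c j q l) * comulRight k (c i l m) -
        swap12 k (∑ l, inclRight k (c i q l) * comulRight k (c j l m))) :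
    (ofStructureConstants c).IsLie := by
  refine Pseudobracket.isLie_of_span _ (Set.range fun i => (Pi.single i 1 : Fin n → k[X])) ?_ ?_ ?_
  · have h := (Pi.basisFun k[X] (Fin n)).span_eq
    rwa [show ⇑(Pi.basisFun k[X] (Fin n)) = fun i => (Pi.single i 1 : Fin n → k[X]) from
      funext fun i => Pi.basisFun_apply ..] at h
  · rintro _ ⟨i, rfl⟩ _ ⟨j, rfl⟩
    simp only [ofStructureConstants_br_single, map_sum, LinearMap.rTensor_tmul,
      ← Finset.sum_neg_distrib, ← TensorProduct.neg_tmul]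
    exact Finset.sum_congr rfl fun l _ => congrArg (· ⊗ₜ _) (hskew i j l)
  · rintro _ ⟨i, rfl⟩ _ ⟨j, rfl⟩ _ ⟨q, rfl⟩
    simp only [ofStructureConstants_br_single, map_sum, Pseudobracket.extLeft_tmul,
      Pseudobracket.extRight_tmul, LinearMap.rTensor_tmul, Finset.smul_sum,
      TensorProduct.smul_tmul', smul_eq_mul, AlgHom.toLinearMap_apply]
    -- Interchanging the sums collects the coefficient of each generator, to which `hjac` applies.
    rw [Finset.sum_comm, Finset.sum_comm (γ := Fin n) (f := fun l m =>
      (inclRight k (c j q l) * comulRight k (c i l m)) ⊗ₜ[k[X]]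
        (Pi.single m 1 : Fin n → k[X])), Finset.sum_comm (γ := Fin n) (f := fun l m =>
      swap12 k (inclRight k (c i q l) * comulRight k (c j l m)) ⊗ₜ[k[X]]
        (Pi.single m 1 : Fin n → k[X]))]
    simp only [← TensorProduct.sum_tmul, ← map_sum, hjac, TensorProduct.sub_tmul,
      Finset.sum_sub_distrib]

end StructureConstants

/-! ### The extended Schrödinger–Virasoro algebra satisfies the Lie axioms -/

section ExtSV

/-- The values of the structure constants of `extSV`. -/
def extSVValue {k : Type*} [Field k] (x y : k) : Fin 4 → Fin 4 → Fin 4 → k :=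
  ![![![y - x, 0, 0, 0], ![0, y - 1 / 2 * x, 0, 0], ![0, 0, y, 0], ![0, 0, 0, y]],
    ![![0, 1 / 2 * y - x, 0, 0], ![0, 0, y - x, 0], ![0, 0, 0, 0], ![0, -1, 0, 0]],
    ![![0, 0, -x, 0], ![0, 0, 0, 0], ![0, 0, 0, 0], ![0, 0, -2, 0]],
    ![![0, 0, 0, -x], ![0, 1, 0, 0], ![0, 0, 2, 0], ![0, 0, 0, 0]]]

theorem ev2_extSV {k : Type*} [Field k] (i j l : Fin 4) (x y : k) :
    ev2 x y (if i ≤ j then extSVUpper k i j l else -swap k (extSVUpper k j i l)) =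
      extSVValue x y i j l := by
  fin_cases i <;> fin_cases j <;> fin_cases l <;> simp [extSVUpper, extSVValue]

theorem extSVValue_skew {k : Type*} [Field k] (i j l : Fin 4) (x y : k) :
    extSVValue x y i j l = -extSVValue y x j i l := by
  fin_cases i <;> fin_cases j <;> fin_cases l <;> simp [extSVValue]

set_option maxHeartbeats 2000000 in
-- a finite check of 256 identities between polynomials
theorem extSVValue_jacobi {k : Type*} [Field k] [CharZero k] (i j q m : Fin 4) (x y z : k) :
    ∑ l, extSVValue x y i j l * extSVValue (x + y) z l q m =
      ∑ l, extSVValue y z j q l * extSVValue x (y + z) i l m -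
        ∑ l, extSVValue x z i q l * extSVValue y (x + z) j l m := by
  simp only [Fin.sum_univ_four]
  fin_cases i <;> fin_cases j <;> fin_cases q <;>
    simp only [extSVValue, Fin.zero_eta, Fin.mk_one, Fin.reduceFinMk, Matrix.cons_val,
      Matrix.cons_val_zero, Matrix.cons_val_one, zero_mul, zero_add, add_zero] <;>
    fin_cases m <;>
    (try simp only [Fin.zero_eta, Fin.mk_one, Fin.reduceFinMk, Matrix.cons_val,
      Matrix.cons_val_zero, Matrix.cons_val_one]) <;> ring

theorem extSV_isLie (k : Type*) [Field k] [CharZero k] : (extSV k).IsLie := by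
  refine ofStructureConstants_isLie _ (fun i j l => H2.ext_ev2 fun x y => ?_)
    fun i j q m => H3.ext_ev3 fun x y z => ?_
  · rw [map_neg, ev2_swap, ev2_extSV, ev2_extSV, extSVValue_skew]
  · simp only [map_sum, map_sub, map_mul, ev3_swap12, ev3_inclLeft, ev3_inclRight,
      ev3_comulLeft, ev3_comulRight, ev2_extSV]
    exact extSVValue_jacobi i j q m x y z

end ExtSV

/-! ### The extended Schrödinger–Virasoro algebra in the basis of negatives -/

section ExtSVBasis

variable (k : Type*) [Field k]

theorem extSV_br_single (i j : Fin 4) :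
    (extSV k).br (Pi.single i 1) (Pi.single j 1) =
      ∑ l, (if i ≤ j then extSVUpper k i j l else -swap k (extSVUpper k j i l)) ⊗ₜ[k[X]]
        (Pi.single l 1 : Fin 4 → k[X]) :=
  ofStructureConstants_br_single _ i j

/-- The basis `-L, -Y, -M, -N` of the extended Schrödinger–Virasoro conformal algebra. -/
noncomputable def extSVBasis : Module.Basis (Fin 4) k[X] (Fin 4 → k[X]) :=
  (Pi.basisFun k[X] (Fin 4)).map (LinearEquiv.neg k[X])

theorem extSVBasis_apply (i : Fin 4) : extSVBasis k i = -Pi.single i 1 := by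
  simp [extSVBasis]

variable [CharZero k]

/-- The two signs in the arguments cancel, while expanding the result in the negated basis changes
the sign of every structure constant. This produces the normalization `s ⊗ 1 - 1 ⊗ s` of `[e₀, e₀]`.
-/
theorem extSV_br_basis (i j : Fin 4) :
    (extSV k).br (extSVBasis k i) (extSVBasis k j) =
      ∑ l, (-if i ≤ j then extSVUpper k i j l else -swap k (extSVUpper k j i l)) ⊗ₜ[k[X]]
        extSVBasis k l := by
  have hneg (a b : Fin 4 → k[X]) : (extSV k).br (-a) (-b) = (extSV k).br a b := by
    have h : ((-1 : k[X]) ⊠ (-1 : k[X]) : H2 k) = 1 := H2.ext_ev2 fun x y => by simp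
    rw [← neg_one_smul k[X] a, ← neg_one_smul k[X] b, (extSV k).sesq, h, one_smul]
  simp only [extSVBasis_apply, hneg, extSV_br_single, TensorProduct.neg_tmul,
    TensorProduct.tmul_neg, neg_neg]

/-- The coefficients of the extended Schrödinger–Virasoro conformal algebra. -/
noncomputable def extSVCoeffs : Coeffs k where
  l1 := 1 / 2
  l2 := 0
  l3 := 0
  k1 := 0
  k2 := 0
  k3 := 0
  -- Unsimplified scalars, here and in `2 * 1` below, match `Coeffs.CommonLast` with `a = 1`, `w =
  -- -1` so that its equations hold by `rfl`.
  alpha := (-1 : k) • (1 ⊠ dp 1 - dp 1 ⊠ 1)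
  eta := 0
  eta11 := (1 : k) • 1 ⊠ 1
  eta12 := 0
  eta21 := 0
  eta22 := (2 * 1 : k) • 1 ⊠ 1

theorem extSV_hasBrackets : HasBrackets (extSV k) (extSVBasis k) (extSVCoeffs k) := by
  constructor <;> rw [extSV_br_basis] <;>
    simp [Fin.sum_univ_four, extSVUpper, extSVCoeffs]
  all_goals
    refine congrArg (· ⊗ₜ _) (H2.ext_ev2 fun x y => ?_)
    simp

theorem extSVCoeffs_E14With : (extSVCoeffs k).E14With 1 (-1) (1 / 2) 0 := by
  refine ⟨⟨one_ne_zero, rfl, rfl, rfl, rfl, neg_ne_zero.mpr one_ne_zero, rfl⟩, rfl, rfl, rfl,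
    ?_, ?_, rfl, rfl⟩ <;> simp [extSVCoeffs]

end ExtSVBasis

end SVPseudo

theorem theorem5p5 (k : Type*) [Field k] [CharZero k] :
    (∀ (L : Type*) [AddCommGroup L] [Module k[X] L] (p : Pseudobracket k L)
        (e : Module.Basis (Fin 4) k[X] L) (d : Coeffs k),
      p.IsLie → HasBrackets p e d →
      ¬ (d.eta11 = 0 ∧ d.eta12 = 0 ∧ d.eta21 = 0 ∧ d.eta22 = 0) →
      d.eta = 0 → d.alpha ≠ 0 →
      d.E1 ∨ d.E2 ∨ d.E3 ∨ d.E4 ∨ d.E5 ∨ d.E6 ∨ d.E7 ∨ d.E8 ∨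
      d.E9 ∨ d.E10 ∨ d.E11 ∨ d.E12 ∨ d.E13 ∨ d.E14 ∨ d.E15 ∨ d.E16) ∧
    ((extSV k).IsLie ∧
      ∃ (e : Module.Basis (Fin 4) k[X] (Fin 4 → k[X])) (d : Coeffs k),
        e 0 = -Pi.single 0 1 ∧ e 1 = -Pi.single 1 1 ∧ e 2 = -Pi.single 2 1 ∧
        e 3 = -Pi.single 3 1 ∧
        HasBrackets (extSV k) e d ∧ d.E14With 1 (-1) (1 / 2) 0) := by
  refine ⟨fun L _ _ p e d hL hB hne hη hα => ?_, extSV_isLie k, extSVBasis k, extSVCoeffs k,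
    extSVBasis_apply k 0, extSVBasis_apply k 1, extSVBasis_apply k 2, extSVBasis_apply k 3,
    extSV_hasBrackets k, extSVCoeffs_E14With k⟩
  simpa only [or_assoc] using hB.classification hL hne hη hα
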